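/- Let $a,b,m$ be natural numbers with $a,b\ge 1$ and let $f\in\mathbb R[x,y]$ be weighted homogeneous of type $(a,b;m)$, i.e. $f(\lambda^a x,\lambda^b y)=\lambda^m f(x,y)$ for all $\lambda,x,y\in\mathbb R$, with an isolated singularity at the origin: $f=f_x=f_y=0$ at $(0,0)$, and some neighbourhood of $(0,0)$ in $\mathbb R^2$ contains no other common zero of $f,f_x,f_y$. For a test function $\varphi\in C_c^\infty(\mathbb R^2)$ (real-valued) let $$Z_{f,\varphi}(s)=\int_{\mathbb R^2}|f(x,y)|^s\varphi(x,y)\,\mathrm dx\,\mathrm dy,\qquad \operatorname{Re}s>0.$$ Then $Z_{f,\varphi}$ has a meromorphic continuation to $\operatorname{Re}s>-1$ for every $\varphi$, and poles below are poles of this continuation. Let $d$ be an integer with $0<d<m$. By a representation of $d$ we mean a pair $(i,j)$ of integers $i,j\ge 0$ with $d=(i+1)a+(j+1)b$. (a) If $f(x,y)=f(-x,-y)$ or $f(x,y)=-f(-x,-y)$, and $i+j$ is odd for every representation of $d$, then $-d/m$ is not a pole of $Z_{f,\varphi}$ for any $\varphi$. The condition that $i+j$ is odd for every representation holds, for example,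 when $d=a+b+\min\{a,b\}$. (b) If $f(x,y)=f(-x,y)$ or $f(x,y)=-f(-x,y)$, and $i$ is odd for every representation of $d$, then $-d/m$ is not a pole of $Z_{f,\varphi}$ for any $\varphi$. (c) If $f(x,y)=f(x,-y)$ or $f(x,y)=-f(x,-y)$, and $j$ is odd for every representation of $d$, then $-d/m$ is not a pole of $Z_{f,\varphi}$ for any $\varphi$. Let $b_f(s)$ denote the Bernstein--Sato polynomial of $f$ over $\mathbb R$, i.e. the monic generator of the ideal of all $b(s)\in\mathbb R[s]$ for which there is $P\in\mathbb R[s,x,y,\partial_x,\partial_y]$ with $P\cdot f^{s+1}=b(s)f^s$. (d) For $f=x^4+y^3$, the number $-5/6$ is a root of $b_f(s)$, but not a pole of $Z_{f,\varphi}$ for any $\varphi$. For $f=x^3+y^5$, the number $-11/15$ is a root of $b_f(s)$, but not a pole of $Z_{f,\varphi}$ for any $\varphi$. -/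

import Mathlib

open scoped ContDiff

/-! ### Real Archimedean zeta functions in two variables -/

namespace RealZeta

/-- The value `f(x, y)` of a real bivariate polynomial. -/
noncomputable def ev (f : MvPolynomial (Fin 2) ℝ) (x y : ℝ) : ℝ :=
  MvPolynomial.eval ![x, y] f

/-- `f` is weighted homogeneous of type `(a, b; m)`. -/
def IsWeightedHomogeneousOfType (f : MvPolynomial (Fin 2) ℝ) (a b m : ℕ) : Prop :=
  ∀ c x y : ℝ, ev f (c ^ a * x) (c ^ b * y) = c ^ m * ev f x y

/-- `(x, y) ∈ ℝ²` is a singular point of the curve `f = 0`. -/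
def IsSingularPoint (f : MvPolynomial (Fin 2) ℝ) (p : ℝ × ℝ) : Prop :=
  ev f p.1 p.2 = 0 ∧ ev (MvPolynomial.pderiv 0 f) p.1 p.2 = 0 ∧
    ev (MvPolynomial.pderiv 1 f) p.1 p.2 = 0

/-- The origin is a singular point, and no other point of `ℝ²` near the origin is singular. -/
def HasIsolatedSingularityAtOrigin (f : MvPolynomial (Fin 2) ℝ) : Prop :=
  IsSingularPoint f (0, 0) ∧ ∀ᶠ p in nhdsWithin (0 : ℝ × ℝ) {0}ᶜ, ¬ IsSingularPoint f p

/-- Test functions: smooth, compactly supported, real-valued functions on `ℝ²`. -/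
def IsTestFunction (φ : ℝ × ℝ → ℝ) : Prop :=
  ContDiff ℝ ∞ φ ∧ HasCompactSupport φ

/-- The integral `∫_{ℝ²} |f(x, y)|^s φ(x, y) dx dy`, which is used only for `Re s > 0`. -/
noncomputable def zetaIntegral (f : MvPolynomial (Fin 2) ℝ) (φ : ℝ × ℝ → ℝ) (s : ℂ) : ℂ :=
  ∫ p : ℝ × ℝ, ((|ev f p.1 p.2| : ℝ) : ℂ) ^ s * (φ p : ℂ)

/-- `F` is a meromorphic continuation of `Z_{f, φ}` from `Re s > 0` to `Re s > -1`. -/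
def IsZetaContinuation (f : MvPolynomial (Fin 2) ℝ) (φ : ℝ × ℝ → ℝ) (F : ℂ → ℂ) : Prop :=
  MeromorphicOn F {s : ℂ | -1 < s.re} ∧ ∀ s : ℂ, 0 < s.re → F s = zetaIntegral f φ s

/-- `s₀` (with `Re s₀ > -1`) is a pole of the meromorphic continuation of `Z_{f, φ}`. -/
def IsZetaPole (f : MvPolynomial (Fin 2) ℝ) (φ : ℝ × ℝ → ℝ) (s₀ : ℂ) : Prop :=
  ∃ F : ℂ → ℂ, IsZetaContinuation f φ F ∧ meromorphicOrderAt F s₀ < 0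

end RealZeta

/-! ### Bernstein-Sato polynomials -/

namespace BernsteinSato

section Localization

variable {A R : Type*} [CommRing A] [CommRing R] [Algebra A R]

/-- The ring homomorphism `r ↦ r + δ(r) ε` from `R` to the dual numbers over `R[1/f]`. -/
noncomputable def toDual (f : R) (δ : Derivation A R R) :
    R →+* TrivSqZeroExt (Localization.Away f) (Localization.Away f) where
  toFun r := (algebraMap R (Localization.Away f) r, algebraMap R (Localization.Away f) (δ r))
  map_one' := by
    ext
    · exact map_one (algebraMap R (Localization.Away f))
    · change algebraMap R (Localization.Away f) (δ 1) = 0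
      simp
  map_mul' r t := by
    ext
    · change algebraMap R (Localization.Away f) (r * t) = algebraMap _ _ r * algebraMap _ _ t
      simp
    · change algebraMap R (Localization.Away f) (δ (r * t)) =
        algebraMap _ _ r • algebraMap _ _ (δ t) +
          MulOpposite.op (algebraMap R (Localization.Away f) t) • algebraMap _ _ (δ r)
      simp [mul_comm]
  map_zero' := by
    ext
    · exact map_zero (algebraMap R (Localization.Away f))
    · change algebraMap R (Localization.Away f) (δ 0) = 0
      simp
  map_add' r t := by
    ext
    · change algebraMap R (Localization.Away f) (r + t) = algebraMap _ _ r + algebraMap _ _ t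
      simp
    · change algebraMap R (Localization.Away f) (δ (r + t)) =
        algebraMap _ _ (δ r) + algebraMap _ _ (δ t)
      simp

theorem isUnit_toDual (f : R) (δ : Derivation A R R) (y : Submonoid.powers f) :
    IsUnit (toDual f δ y) := by
  rw [TrivSqZeroExt.isUnit_iff_isUnit_fst]
  exact IsLocalization.map_units (Localization.Away f) y

/-- The extension `g ↦ g + δ(g) ε` of `toDual` to `R[1/f]`. -/
noncomputable def locDual (f : R) (δ : Derivation A R R) :
    Localization.Away f →+* TrivSqZeroExt (Localization.Away f) (Localization.Away f) :=
  IsLocalization.lift (M := Submonoid.powers f) (isUnit_toDual f δ)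

theorem locDual_algebraMap (f : R) (δ : Derivation A R R) (r : R) :
    locDual f δ (algebraMap R _ r) = toDual f δ r :=
  IsLocalization.lift_eq _ _

theorem fst_locDual (f : R) (δ : Derivation A R R) (g : Localization.Away f) :
    (locDual f δ g).fst = g := by
  have h : (TrivSqZeroExt.fstHom (Localization.Away f) (Localization.Away f)
      (Localization.Away f)).toRingHom.comp (locDual f δ) = RingHom.id _ := by
    apply IsLocalization.ringHom_ext (Submonoid.powers f)
    ext r
    change (locDual f δ (algebraMap R _ r)).fst = algebraMap R _ r
    rw [locDual_algebraMap]
    rfl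
  exact congrArg (fun φ : Localization.Away f →+* Localization.Away f => φ g) h

/-- The unique derivation of `R[1/f]` that extends the derivation `δ` of `R`. -/
noncomputable def locDerivation (f : R) (δ : Derivation A R R) :
    Derivation A (Localization.Away f) (Localization.Away f) :=
  Derivation.mk'
    { toFun := fun g => (locDual f δ g).snd
      map_add' := fun g h => by simp
      map_smul' := fun c g => by
        rw [Algebra.smul_def, IsScalarTower.algebraMap_apply A R (Localization.Away f), map_mul,
          TrivSqZeroExt.snd_mul, locDual_algebraMap]
        have h1 : (toDual f δ (algebraMap A R c)).fst =
            algebraMap R (Localization.Away f) (algebraMap A R c) := rfl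
        have h2 : (toDual f δ (algebraMap A R c)).snd =
            algebraMap R (Localization.Away f) (δ (algebraMap A R c)) := rfl
        rw [h1, h2, Derivation.map_algebraMap, map_zero, smul_zero, add_zero, smul_eq_mul,
          ← IsScalarTower.algebraMap_apply A R (Localization.Away f), ← Algebra.smul_def]
        rfl }
    (fun g h => by
      change (locDual f δ (g * h)).snd = g • (locDual f δ h).snd + h • (locDual f δ g).snd
      rw [map_mul, TrivSqZeroExt.snd_mul, fst_locDual, fst_locDual]
      simp [mul_comm])

theorem locDerivation_algebraMap (f : R) (δ : Derivation A R R) (r : R) :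
    locDerivation f δ (algebraMap R _ r) = algebraMap R _ (δ r) := by
  change (locDual f δ (algebraMap R _ r)).snd = _
  rw [locDual_algebraMap]
  rfl

end Localization

section Polynomial

open Polynomial

variable {σ k : Type*} [Field k]

/-- `f ∈ k[x]` regarded as an element of `k[s][x]`. -/
noncomputable def overS (f : MvPolynomial σ k) : MvPolynomial σ k[X] :=
  MvPolynomial.map Polynomial.C f

/-- The `k[s]`-module `k[s][x][1/f]`. An element `g` stands for `g · f ^ s` in the free module
`k[s][x][1/f] · f ^ s` on the symbol `f ^ s`. The variable `s` is `Polynomial.X`. -/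
abbrev TwistedModule (f : MvPolynomial σ k) : Type _ :=
  Localization.Away (overS f)

/-- The action of `x_i` on `k[s][x][1/f] · f ^ s`. -/
noncomputable def actX (f : MvPolynomial σ k) (i : σ) : Module.End k[X] (TwistedModule f) :=
  LinearMap.mulLeft k[X]
    (algebraMap (MvPolynomial σ k[X]) (TwistedModule f) (MvPolynomial.X i))

/-- The action of `∂/∂x_i` on `k[s][x][1/f] · f ^ s`, namely
`∂_i (g f ^ s) = (∂_i g + s g (∂_i f) / f) f ^ s`. -/
noncomputable def actD (f : MvPolynomial σ k) (i : σ) : Module.End k[X] (TwistedModule f) :=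
  (locDerivation (overS f) (MvPolynomial.pderiv i)).toLinearMap +
    (X : k[X]) • LinearMap.mulLeft k[X]
      (IsLocalization.mk' (TwistedModule f) (MvPolynomial.pderiv i (overS f))
        (⟨overS f, Submonoid.mem_powers _⟩ : Submonoid.powers (overS f)))

/-- The operators on `k[s][x][1/f] · f ^ s` given by the elements of `k[s, x, ∂/∂x]`. -/
noncomputable def operators (f : MvPolynomial σ k) :
    Subalgebra k[X] (Module.End k[X] (TwistedModule f)) :=
  Algebra.adjoin k[X] (Set.range (actX f) ∪ Set.range (actD f))

/-- The ideal of all `b(s) ∈ k[s]` with `P · f ^ (s + 1) = b(s) · f ^ s` for some operator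
`P ∈ k[s, x, ∂/∂x]`; here `f ^ (s + 1)` is `f · f ^ s`. -/
noncomputable def bernsteinSatoIdeal (f : MvPolynomial σ k) : Ideal k[X] where
  carrier := {b | ∃ P ∈ operators f,
    P (algebraMap (MvPolynomial σ k[X]) (TwistedModule f) (overS f)) =
      b • (1 : TwistedModule f)}
  add_mem' := by
    rintro b c ⟨P, hP, hb⟩ ⟨Q, hQ, hc⟩
    exact ⟨P + Q, add_mem hP hQ, by rw [LinearMap.add_apply, hb, hc, add_smul]⟩
  zero_mem' := ⟨0, zero_mem _, by simp⟩
  smul_mem' := by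
    rintro c b ⟨P, hP, hb⟩
    exact ⟨c • P, Subalgebra.smul_mem _ hP c, by
      rw [LinearMap.smul_apply, hb, smul_smul, smul_eq_mul]⟩

/-- The Bernstein-Sato polynomial `b_f(s)`: the monic generator of the ideal above. -/
noncomputable def bernsteinSatoPolynomial (f : MvPolynomial σ k) : k[X] :=
  Submodule.IsPrincipal.generator (bernsteinSatoIdeal f) *
    C (Submodule.IsPrincipal.generator (bernsteinSatoIdeal f)).leadingCoeff⁻¹

end Polynomial

end BernsteinSato

namespace RealZeta

open MeasureTheory Set Filter Topology MvPolynomial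

variable {f : MvPolynomial (Fin 2) ℝ} {a b m : ℕ}

/-! ### Calculus of bivariate polynomials -/

/-! Poles. By Taylor's formula a test function is a finite combination of monomials `x ^ i * y ^ j`
cut off to the unit square, plus a remainder that is `O(|x| ^ m + |y| ^ m)` with bounded support.
The remainder contributes nothing singular: Euler's identity and the isolated singularity make the
zeros of `f` on the lines `x = ±1` and `y = ±1` simple, so weighted scaling shows that `|f| ^ σ`
times the remainder is integrable for every `σ > -1` (`IsFlat.integrable`), and the integral is
analytic there (`IsFlat.exists_analytic`).

For a cut-off monomial, let `I(s)` be its zeta integral and `e = (i + 1) * a + (j + 1) * b`. Scaling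
by `(2 ^ a, 2 ^ b)` gives `(1 - 2 ^ (-(m * s + e))) * I(s) = H(s)`, where `H` comes from a flat
function and is analytic. At `s = -d / m` the factor on the left vanishes only if `d = e`, that is,
if `(i, j)` represents `d` (`exists_meromorphic_truncatedMonomial`). If a reflection preserves `|f|`
and negates the monomial, then `I` is identically zero. The parity hypotheses say that this happens
for every representation of `d`.

Roots of `b_f` for `f = x ^ n + y ^ l`. Take a functional that imitates integration against `exp
(-f)` and sees only exponents congruent to `(i₀, j₀)` modulo `(n, l)`. With `w = (i₀ + 1) / n + (j₀
+ 1) / l`, it sends `x ^ i₀ * y ^ j₀ * f ^ N` to the rising factorial `(w)_N`. Setting `s = N` in `P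
f ^ (s + 1) = b(s) f ^ s` and moving `P` to the other side by integration by parts writes `b(N)
(w)_N` as a combination, with coefficients polynomial in `N`, of values `(w + t)_(N + 1)`. Each of
these is `(N + w) (w)_N` times a polynomial in `N`, so `s + w` divides `b`
(`isRoot_of_mem_bernsteinSatoIdeal`). -/

theorem hasDerivAt_ev (f : MvPolynomial (Fin 2) ℝ) {u v : ℝ → ℝ} {u' v' t : ℝ}
    (hu : HasDerivAt u u' t) (hv : HasDerivAt v v' t) :
    HasDerivAt (fun τ => ev f (u τ) (v τ))
      (ev (pderiv 0 f) (u t) (v t) * u' + ev (pderiv 1 f) (u t) (v t) * v') t := by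
  induction f using MvPolynomial.induction_on with
  | C r => simpa [ev] using hasDerivAt_const t r
  | add p q hp hq =>
    simp only [ev, map_add] at hp hq ⊢
    exact (hp.add hq).congr_deriv (by ring)
  | mul_X p i hp =>
    obtain rfl | rfl : i = 0 ∨ i = 1 := by fin_cases i <;> simp
    · simp only [ev, Derivation.leibniz, map_add, map_mul, eval_X, smul_eq_mul] at hp ⊢
      exact (hp.mul hu).congr_deriv (by simp [pderiv_X]; ring)
    · simp only [ev, Derivation.leibniz, map_add, map_mul, eval_X, smul_eq_mul] at hp ⊢
      exact (hp.mul hv).congr_deriv (by simp [pderiv_X]; ring)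

theorem continuous_ev (f : MvPolynomial (Fin 2) ℝ) :
    Continuous fun p : ℝ × ℝ => ev f p.1 p.2 := by
  unfold ev
  refine (MvPolynomial.continuous_eval f).comp ?_
  refine continuous_pi fun i => ?_
  fin_cases i
  · exact continuous_fst
  · exact continuous_snd

theorem IsWeightedHomogeneousOfType.euler (h : IsWeightedHomogeneousOfType f a b m) (x y : ℝ) :
    a * x * ev (pderiv 0 f) x y + b * y * ev (pderiv 1 f) x y = m * ev f x y := by
  have h1 := hasDerivAt_ev f (((hasDerivAt_id (1 : ℝ)).pow a).mul_const x)
    (((hasDerivAt_id (1 : ℝ)).pow b).mul_const y)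
  have h2 := ((hasDerivAt_id (1 : ℝ)).pow m).mul_const (ev f x y)
  have h3 := h1.unique (h2.congr_of_eventuallyEq (Eventually.of_forall fun t => h t x y))
  simp at h3
  linarith

theorem IsWeightedHomogeneousOfType.pderiv_zero (h : IsWeightedHomogeneousOfType f a b m)
    (c x y : ℝ) : c ^ a * ev (pderiv 0 f) (c ^ a * x) (c ^ b * y) =
      c ^ m * ev (pderiv 0 f) x y := by
  have h1 := hasDerivAt_ev f ((hasDerivAt_id x).const_mul (c ^ a))
    (hasDerivAt_const x (c ^ b * y))
  have h2 := (hasDerivAt_ev f (hasDerivAt_id x) (hasDerivAt_const x y)).const_mul (c ^ m)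
  have h3 := h1.unique (h2.congr_of_eventuallyEq (Eventually.of_forall fun t => h c t y))
  simp at h3
  linarith

theorem IsWeightedHomogeneousOfType.pderiv_one (h : IsWeightedHomogeneousOfType f a b m)
    (c x y : ℝ) : c ^ b * ev (pderiv 1 f) (c ^ a * x) (c ^ b * y) =
      c ^ m * ev (pderiv 1 f) x y := by
  have h1 := hasDerivAt_ev f (hasDerivAt_const y (c ^ a * x))
    ((hasDerivAt_id y).const_mul (c ^ b))
  have h2 := (hasDerivAt_ev f (hasDerivAt_const y x) (hasDerivAt_id y)).const_mul (c ^ m)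
  have h3 := h1.unique (h2.congr_of_eventuallyEq (Eventually.of_forall fun t => h c x t))
  simp at h3
  linarith

theorem IsSingularPoint.scale (h : IsWeightedHomogeneousOfType f a b m) {x y c : ℝ}
    (hs : IsSingularPoint f (x, y)) (hc : c ≠ 0) : IsSingularPoint f (c ^ a * x, c ^ b * y) := by
  obtain ⟨h0, h1, h2⟩ := hs
  simp only at h0 h1 h2
  refine ⟨by simp only [h c x y, h0, mul_zero], ?_, ?_⟩
  · have := h.pderiv_zero c x y
    rw [h1, mul_zero] at this
    exact (mul_eq_zero.1 this).resolve_left (pow_ne_zero _ hc)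
  · have := h.pderiv_one c x y
    rw [h2, mul_zero] at this
    exact (mul_eq_zero.1 this).resolve_left (pow_ne_zero _ hc)

/-- An isolated singularity of a weighted homogeneous polynomial is the only real one. -/
theorem not_isSingularPoint (ha : 0 < a) (hb : 0 < b) (h : IsWeightedHomogeneousOfType f a b m)
    (hf : HasIsolatedSingularityAtOrigin f) {x y : ℝ} (hxy : (x, y) ≠ (0 : ℝ × ℝ)) :
    ¬ IsSingularPoint f (x, y) := by
  intro hs
  have hcont : Continuous fun c : ℝ => (c ^ a * x, c ^ b * y) := by fun_prop
  -- The weighted orbit of a singular point consists of singular points and runs into the origin as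
  -- `c → 0`.
  have ht : Tendsto (fun c : ℝ => (c ^ a * x, c ^ b * y)) (𝓝[≠] 0) (𝓝[≠] (0 : ℝ × ℝ)) := by
    refine tendsto_nhdsWithin_iff.2 ⟨?_, ?_⟩
    · have := hcont.tendsto 0
      simp only [ne_eq, ha.ne', hb.ne', not_false_eq_true, zero_pow, zero_mul] at this
      exact this.mono_left nhdsWithin_le_nhds
    · filter_upwards [self_mem_nhdsWithin] with c hc
      have hc : c ≠ 0 := hc
      simp only [mem_compl_iff, mem_singleton_iff, Prod.mk_eq_zero, mul_eq_zero, pow_eq_zero_iff',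
        hc, false_and, false_or]
      simpa using hxy
  obtain ⟨c, hc1, hc2⟩ := ((ht.eventually hf.2).and self_mem_nhdsWithin).exists
  exact hc1 (hs.scale h hc2)

/-- If `f` and `f_y` vanish at a point with `x ≠ 0`, Euler's identity forces `f_x = 0`, so the point
would be singular. Hence `f` has only simple zeros on each line `x = ε ≠ 0`. -/
theorem ev_pderiv_one_ne_zero (ha : 0 < a) (hb : 0 < b)
    (h : IsWeightedHomogeneousOfType f a b m) (hf : HasIsolatedSingularityAtOrigin f)
    {x y : ℝ} (hx : x ≠ 0) (h0 : ev f x y = 0) : ev (pderiv 1 f) x y ≠ 0 := by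
  intro h1
  have he := h.euler x y
  rw [h0, h1] at he
  refine not_isSingularPoint ha hb h hf (x := x) (y := y) (by simp [hx]) ⟨h0, ?_, h1⟩
  have ha' : (a : ℝ) ≠ 0 := by positivity
  simpa [hx, ha'] using he

theorem ev_pderiv_zero_ne_zero (ha : 0 < a) (hb : 0 < b)
    (h : IsWeightedHomogeneousOfType f a b m) (hf : HasIsolatedSingularityAtOrigin f)
    {x y : ℝ} (hy : y ≠ 0) (h0 : ev f x y = 0) : ev (pderiv 0 f) x y ≠ 0 := by
  intro h1
  have he := h.euler x y
  rw [h0, h1] at he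
  refine not_isSingularPoint ha hb h hf (x := x) (y := y) (by simp [hy]) ⟨h0, h1, ?_⟩
  have hb' : (b : ℝ) ≠ 0 := by positivity
  simpa [hy, hb'] using he

end RealZeta

namespace RealZeta

open MeasureTheory Set Filter Topology MvPolynomial

variable {f : MvPolynomial (Fin 2) ℝ} {a b m : ℕ}

/-! ### Integrability -/

theorem intervalIntegrable_abs_sub_rpow {σ : ℝ} (hσ : -1 < σ) (c : ℝ) :
    IntervalIntegrable (fun v : ℝ => |v - c| ^ σ) volume (c - 1) (c + 1) := by
  have h1 : IntervalIntegrable (fun v : ℝ => |v| ^ σ) volume 0 1 := by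
    refine (intervalIntegral.intervalIntegrable_rpow' hσ).congr fun v hv => ?_
    rw [uIoc_of_le zero_le_one] at hv
    simp [abs_of_pos hv.1]
  have h2 : IntervalIntegrable (fun v : ℝ => |v| ^ σ) volume (-1) 0 := by
    have := (IntervalIntegrable.iff_comp_neg).1 h1
    simpa using this.symm
  simpa [add_comm, sub_eq_add_neg] using (h2.trans h1).comp_sub_right c

/-- Near a simple zero `v` one has `|g w| ≥ c * |w - v|`, so for negative `σ` the function is
dominated by `c ^ σ * |w - v| ^ σ`, which is integrable as `σ > -1`. Elsewhere it is continuous. -/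
theorem integrableOn_abs_rpow_of_simple_zeros {g g' : ℝ → ℝ} (hg : ∀ v, HasDerivAt g (g' v) v)
    (h0 : ∀ v, g v = 0 → g' v ≠ 0) {σ : ℝ} (hσ : -1 < σ) :
    IntegrableOn (fun v => |g v| ^ σ) (Icc (-1) 1) := by
  have hc : Continuous g := continuous_iff_continuousAt.2 fun v => (hg v).continuousAt
  have hmeas : Measurable fun v => |g v| ^ σ := hc.measurable.abs.pow_const σ
  refine LocallyIntegrable.integrableOn_isCompact (fun v => ?_) isCompact_Icc
  rcases le_or_gt 0 σ with hσ0 | hσ0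
  · exact (hc.abs.rpow_const fun _ => Or.inr hσ0).locallyIntegrable v
  by_cases hv : g v = 0
  · obtain ⟨c, hc0, hlow⟩ : ∃ c > 0, ∀ᶠ w in 𝓝 v, c * |w - v| ≤ |g w| := by
      have hpos : 0 < |g' v| := abs_pos.2 (h0 v hv)
      refine ⟨|g' v| / 2, by positivity, ?_⟩
      have := (hg v).tendsto_slope.abs.eventually (lt_mem_nhds (half_lt_self hpos))
      rw [eventually_nhdsWithin_iff] at this
      filter_upwards [this] with w hw
      by_cases hwv : w = v
      · simp [hwv]
      · have hlt := hw hwv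
        have hpos' : 0 < |w - v| := abs_pos.2 (sub_ne_zero.2 hwv)
        rw [slope_def_field, hv, sub_zero, abs_div, lt_div_iff₀ hpos'] at hlt
        exact hlt.le
    have hI : IntegrableAtFilter (fun w => c ^ σ * |w - v| ^ σ) (𝓝 v) := by
      refine ⟨Ioc (v - 1) (v + 1), Ioc_mem_nhds (by linarith) (by linarith), ?_⟩
      exact ((intervalIntegrable_iff_integrableOn_Ioc_of_le (by linarith)).1
        (intervalIntegrable_abs_sub_rpow hσ v)).const_mul _
    obtain ⟨s, hs, hsI⟩ := hI
    obtain ⟨t, ht, htm, htv⟩ := eventually_nhds_iff.1 (hlow.and hs)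
    refine ⟨t, htm.mem_nhds htv, ?_⟩
    refine Integrable.mono' (hsI.mono_set fun w hw => (ht w hw).2) hmeas.aestronglyMeasurable ?_
    have hne : ∀ᵐ w ∂(volume.restrict t), w ≠ v :=
      ae_restrict_of_ae (by simp [ae_iff])
    filter_upwards [ae_restrict_mem htm.measurableSet, hne] with w hw hwv
    have hpos : 0 < |w - v| := abs_pos.2 (sub_ne_zero.2 hwv)
    rw [Real.norm_of_nonneg (by positivity), ← Real.mul_rpow hc0.le hpos.le]
    exact Real.rpow_le_rpow_of_nonpos (by positivity) (ht w hw).1 hσ0.le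
  · have hca : ContinuousAt (fun w => |g w| ^ σ) v :=
      (hc.abs.continuousAt).rpow_const (Or.inl (abs_ne_zero.2 hv))
    exact hca.tendsto.integrableAtFilter hmeas.stronglyMeasurable.stronglyMeasurableAtFilter
      (volume.finiteAt_nhds v)

theorem lintegral_eq_mul_lintegral_comp_mul {c : ℝ} (hc : 0 < c) {g : ℝ → ENNReal} :
    ∫⁻ y, g y = ENNReal.ofReal c * ∫⁻ v, g (c * v) := by
  have h := Real.smul_map_volume_mul_left hc.ne'
  rw [abs_of_pos hc] at h
  conv_lhs => rw [← h]
  rw [lintegral_smul_measure, smul_eq_mul]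
  congr 1
  exact (Homeomorph.mulLeft₀ c hc.ne').toMeasurableEquiv.measurableEmbedding.lintegral_map _

/-- The fibre over `x` of the integral of `|g| ^ σ ψ` over the region `|y| ^ a ≤ |x| ^ b`. -/
theorem lintegral_fiber_le {g : ℝ → ℝ → ℝ}
    (hom : ∀ t x y : ℝ, g (t ^ a * x) (t ^ b * y) = t ^ m * g x y) {σ : ℝ} {J : ENNReal}
    {ε t : ℝ} (ht : 0 < t)
    (hJ : ∫⁻ v in Icc (-1 : ℝ) 1, ENNReal.ofReal (|g ε v| ^ σ) ≤ J)
    {K : ℝ} (hK : 0 ≤ K) {ψ : ℝ → ℝ} (hψ : ∀ y, |y| ≤ t ^ b → |ψ y| ≤ K)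
    (hψ0 : ∀ y, t ^ b < |y| → ψ y = 0) :
    ∫⁻ y, ENNReal.ofReal (|g (t ^ a * ε) y| ^ σ * |ψ y|) ≤
      ENNReal.ofReal (t ^ b * (t ^ m) ^ σ * K) * J := by
  have htb : 0 < t ^ b := by positivity
  have hm : 0 ≤ (t ^ m) ^ σ := by positivity
  -- The substitution `y = t ^ b * v` turns the fibre of the region into `|v| ≤ 1`, and homogeneity
  -- pulls `t ^ m` out of `g`.
  rw [lintegral_eq_mul_lintegral_comp_mul htb, ENNReal.ofReal_mul (by positivity),
    ENNReal.ofReal_mul htb.le, mul_assoc, mul_assoc]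
  gcongr
  calc ∫⁻ v, ENNReal.ofReal (|g (t ^ a * ε) (t ^ b * v)| ^ σ * |ψ (t ^ b * v)|)
      ≤ ∫⁻ v, (Icc (-1 : ℝ) 1).indicator (fun v => ENNReal.ofReal ((t ^ m) ^ σ) *
          (ENNReal.ofReal K * ENNReal.ofReal (|g ε v| ^ σ))) v := by
        refine lintegral_mono fun v => ?_
        by_cases hv : v ∈ Icc (-1 : ℝ) 1
        · rw [indicator_of_mem hv, hom, abs_mul, Real.mul_rpow (abs_nonneg _) (abs_nonneg _),
            abs_of_pos (by positivity : 0 < t ^ m), ← ENNReal.ofReal_mul hK,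
            ← ENNReal.ofReal_mul hm]
          refine ENNReal.ofReal_le_ofReal ?_
          have : |ψ (t ^ b * v)| ≤ K := hψ _ (by
            rw [abs_mul, abs_of_pos htb]
            exact mul_le_of_le_one_right htb.le (abs_le.2 hv))
          have h3 : 0 ≤ |g ε v| ^ σ := by positivity
          calc _ ≤ (t ^ m) ^ σ * |g ε v| ^ σ * K := by gcongr
            _ = _ := by ring
        · have : ψ (t ^ b * v) = 0 := hψ0 _ (by
            rw [abs_mul, abs_of_pos htb]
            refine lt_mul_of_one_lt_right htb ?_
            by_contra h
            exact hv (abs_le.1 (not_lt.1 h)))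
          simp [this]
    _ ≤ _ := by
        rw [lintegral_indicator measurableSet_Icc, lintegral_const_mul' _ _ ENNReal.ofReal_ne_top,
          lintegral_const_mul' _ _ ENNReal.ofReal_ne_top]
        gcongr

/-- Measurable functions of bounded support on the plane that are `O(|x| ^ m + |y| ^ m)`. -/
def IsFlat (m : ℕ) (ψ : ℝ × ℝ → ℝ) : Prop :=
  Measurable ψ ∧ ∃ C R : ℝ, 0 ≤ C ∧ 1 ≤ R ∧
    ∀ p : ℝ × ℝ, |ψ p| ≤ C * (|p.1| ^ m + |p.2| ^ m) ∧ (R < |p.1| ∨ R < |p.2| → ψ p = 0)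

/-- Fibre over `x = ± t ^ a`: the region is `|y| ≤ t ^ b`, where rescaling bounds the integral by `t
^ b * t ^ (m * σ)` times the flat bound on `ψ`, which is of order `t ^ m`. Since `σ + 1 > 0`, the
fibre integrals stay bounded as `t → 0`. -/
theorem IsFlat.lintegral_region_lt_top {g : ℝ → ℝ → ℝ} (hg : Measurable fun p : ℝ × ℝ => g p.1 p.2)
    (ha : 0 < a) (hb : 0 < b)
    (hom : ∀ t x y : ℝ, g (t ^ a * x) (t ^ b * y) = t ^ m * g x y) {σ : ℝ} (hσ : -1 < σ)
    (hJ : ∀ ε : ℝ, ε ≠ 0 → IntegrableOn (fun v => |g ε v| ^ σ) (Icc (-1) 1))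
    {ψ : ℝ × ℝ → ℝ} (hψ : IsFlat m ψ) :
    ∫⁻ p : ℝ × ℝ in {p | |p.2| ^ a ≤ |p.1| ^ b}, ENNReal.ofReal (|g p.1 p.2| ^ σ * |ψ p|) < ⊤ := by
  obtain ⟨hψm, C, R, hC, hR, hψ⟩ := hψ
  have hS : MeasurableSet {p : ℝ × ℝ | |p.2| ^ a ≤ |p.1| ^ b} :=
    measurableSet_le (by fun_prop) (by fun_prop)
  rw [← lintegral_indicator hS]
  have hfm : Measurable fun p : ℝ × ℝ => ENNReal.ofReal (|g p.1 p.2| ^ σ * |ψ p|) :=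
    ((hg.abs.pow_const σ).mul hψm.abs).ennreal_ofReal
  rw [Measure.volume_eq_prod, lintegral_prod _ (hfm.indicator hS).aemeasurable]
  set T : ℝ := R ^ ((a : ℝ)⁻¹) with hT
  have hT1 : 1 ≤ T := Real.one_le_rpow hR (by positivity)
  -- One bound serves both signs of `x`.
  set J : ENNReal := (∫⁻ v in Icc (-1 : ℝ) 1, ENNReal.ofReal (|g 1 v| ^ σ)) +
    ∫⁻ v in Icc (-1 : ℝ) 1, ENNReal.ofReal (|g (-1) v| ^ σ) with hJdef
  have hJtop : J < ⊤ := by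
    refine ENNReal.add_lt_top.2 ⟨?_, ?_⟩
    · exact (hJ 1 one_ne_zero).lintegral_lt_top
    · exact (hJ (-1) (by norm_num)).lintegral_lt_top
  set M : ENNReal := ENNReal.ofReal (T ^ b * (T ^ m) ^ (σ + 1) * (C * (T ^ (a * m) + T ^ (b * m))))
    * J with hM
  have key : ∀ x : ℝ, x ≠ 0 → ∫⁻ y, ({p : ℝ × ℝ | |p.2| ^ a ≤ |p.1| ^ b}).indicator
      (fun p => ENNReal.ofReal (|g p.1 p.2| ^ σ * |ψ p|)) (x, y) ≤
        (Icc (-R) R).indicator (fun _ => M) x := by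
    intro x hx
    by_cases hxR : x ∈ Icc (-R) R
    swap
    · have h0 : ∀ y, ψ (x, y) = 0 := fun y => (hψ (x, y)).2 (Or.inl (by
        by_contra h
        exact hxR (abs_le.1 (not_lt.1 h))))
      simp [h0, Set.indicator]
    rw [indicator_of_mem hxR]
    set t : ℝ := |x| ^ ((a : ℝ)⁻¹) with ht
    have htpos : 0 < t := Real.rpow_pos_of_pos (abs_pos.2 hx) _
    have hta : t ^ a = |x| := Real.rpow_inv_natCast_pow (abs_nonneg x) ha.ne'
    have htT : t ≤ T := Real.rpow_le_rpow (abs_nonneg x) (abs_le.2 hxR) (by positivity)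
    obtain ⟨ε, hε, hxe⟩ : ∃ ε : ℝ, (ε = 1 ∨ ε = -1) ∧ x = t ^ a * ε := by
      rcases lt_or_gt_of_ne hx with h | h
      · exact ⟨-1, Or.inr rfl, by rw [hta, abs_of_neg h]; ring⟩
      · exact ⟨1, Or.inl rfl, by rw [hta, abs_of_pos h]; ring⟩
    have hregion : ∀ y : ℝ, |y| ^ a ≤ |x| ^ b ↔ |y| ≤ t ^ b := by
      intro y
      rw [← hta, ← pow_mul, mul_comm, pow_mul]
      exact pow_le_pow_iff_left₀ (abs_nonneg y) (by positivity) ha.ne'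
    have hJε : ∫⁻ v in Icc (-1 : ℝ) 1, ENNReal.ofReal (|g ε v| ^ σ) ≤ J := by
      rcases hε with rfl | rfl
      · exact le_self_add
      · exact le_add_self
    -- On the fibre `|x| ^ m = (t ^ a) ^ m` and `|y| ^ m ≤ (t ^ b) ^ m`. As `a, b ≥ 1` and `t ≤ T`,
    -- both are at most a constant times `t ^ m`.
    set K : ℝ := t ^ m * (C * (T ^ (a * m) + T ^ (b * m))) with hK
    have hpow : ∀ k : ℕ, 0 < k → (t ^ k) ^ m ≤ t ^ m * T ^ (k * m) := by
      intro k hk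
      obtain ⟨l, rfl⟩ : ∃ l, k = l + 1 := ⟨k - 1, by omega⟩
      rw [← pow_mul, add_mul, one_mul, pow_add, pow_add, mul_comm]
      have h1 : t ^ (l * m) ≤ T ^ (l * m) := by gcongr
      have h2 : 1 ≤ T ^ m := one_le_pow₀ hT1
      calc t ^ m * t ^ (l * m) ≤ t ^ m * T ^ (l * m) := by gcongr
        _ ≤ t ^ m * (T ^ (l * m) * T ^ m) := by
          gcongr
          exact le_mul_of_one_le_right (by positivity) h2
    have hfib := lintegral_fiber_le (g := g) (a := a) (b := b) (m := m) hom (σ := σ) (ε := ε)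
      htpos hJε (K := K) (by positivity)
      (ψ := fun y => if |y| ≤ t ^ b then ψ (x, y) else 0) (fun y hy => by
        rw [if_pos hy]
        refine ((hψ (x, y)).1).trans ?_
        calc C * (|x| ^ m + |y| ^ m) ≤ C * ((t ^ a) ^ m + (t ^ b) ^ m) := by rw [hta]; gcongr
          _ ≤ C * (t ^ m * T ^ (a * m) + t ^ m * T ^ (b * m)) := by
            gcongr
            · exact hpow a ha
            · exact hpow b hb
          _ = K := by rw [hK]; ring) (fun y hy => if_neg (not_le.2 hy))
    rw [← hxe] at hfib
    calc _ = ∫⁻ y, ENNReal.ofReal (|g x y| ^ σ * |if |y| ≤ t ^ b then ψ (x, y) else 0|) := by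
          refine lintegral_congr fun y => ?_
          by_cases hy : |y| ≤ t ^ b
          · rw [indicator_of_mem (by exact (hregion y).2 hy), if_pos hy]
          · have hy' : (x, y) ∉ {p : ℝ × ℝ | |p.2| ^ a ≤ |p.1| ^ b} := fun h => hy ((hregion y).1 h)
            rw [indicator_of_notMem hy', if_neg hy]
            simp
      _ ≤ _ := hfib
      -- The `t ^ m` contained in `K` raises the exponent `σ` to `σ + 1`, which is positive, so `t`
      -- may be replaced by its maximum `T`.
      _ ≤ M := by
        rw [hM]
        refine mul_le_mul_left (ENNReal.ofReal_le_ofReal ?_) _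
        calc t ^ b * (t ^ m) ^ σ * K
            = t ^ b * (t ^ m) ^ (σ + 1) * (C * (T ^ (a * m) + T ^ (b * m))) := by
              rw [Real.rpow_add_one (by positivity), hK]; ring
          _ ≤ _ := by
              have : (t ^ m) ^ (σ + 1) ≤ (T ^ m) ^ (σ + 1) :=
                Real.rpow_le_rpow (by positivity) (by gcongr) (by linarith)
              gcongr
  calc _ ≤ ∫⁻ x, (Icc (-R) R).indicator (fun _ => M) x := by
        refine lintegral_mono_ae ?_
        have : ∀ᵐ x : ℝ, x ≠ 0 := by simp [ae_iff]
        filter_upwards [this] with x hx using key x hx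
    _ < ⊤ := by
        rw [lintegral_indicator measurableSet_Icc, lintegral_const]
        exact ENNReal.mul_lt_top (ENNReal.mul_lt_top ENNReal.ofReal_lt_top hJtop) (by simp)

theorem IsFlat.swap {ψ : ℝ × ℝ → ℝ} (h : IsFlat m ψ) : IsFlat m fun p => ψ p.swap := by
  obtain ⟨hm, C, R, hC, hR, hψ⟩ := h
  refine ⟨hm.comp measurable_swap, C, R, hC, hR, fun p => ⟨?_, fun hp => (hψ p.swap).2 hp.symm⟩⟩
  simpa [add_comm] using (hψ p.swap).1

theorem integrableOn_abs_ev_right (ha : 0 < a) (hb : 0 < b)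
    (h : IsWeightedHomogeneousOfType f a b m) (hf : HasIsolatedSingularityAtOrigin f)
    {σ : ℝ} (hσ : -1 < σ) {ε : ℝ} (hε : ε ≠ 0) :
    IntegrableOn (fun v => |ev f ε v| ^ σ) (Icc (-1) 1) := by
  refine integrableOn_abs_rpow_of_simple_zeros (g' := fun v => ev (pderiv 1 f) ε v)
    (fun v => ?_) (fun v hv => ev_pderiv_one_ne_zero ha hb h hf hε hv) hσ
  exact (hasDerivAt_ev f (hasDerivAt_const v ε) (hasDerivAt_id v)).congr_deriv (by simp)

theorem integrableOn_abs_ev_left (ha : 0 < a) (hb : 0 < b)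
    (h : IsWeightedHomogeneousOfType f a b m) (hf : HasIsolatedSingularityAtOrigin f)
    {σ : ℝ} (hσ : -1 < σ) {ε : ℝ} (hε : ε ≠ 0) :
    IntegrableOn (fun v => |ev f v ε| ^ σ) (Icc (-1) 1) := by
  refine integrableOn_abs_rpow_of_simple_zeros (g' := fun v => ev (pderiv 0 f) v ε)
    (fun v => ?_) (fun v hv => ev_pderiv_zero_ne_zero ha hb h hf hε hv) hσ
  exact (hasDerivAt_ev f (hasDerivAt_id v) (hasDerivAt_const v ε)).congr_deriv (by simp)

/-- The regions `|y| ^ a ≤ |x| ^ b` and `|x| ^ b ≤ |y| ^ a` cover the plane. Exchanging the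
coordinates, together with `a` and `b`, reduces the second to the first. -/
theorem IsFlat.integrable (ha : 0 < a) (hb : 0 < b) (h : IsWeightedHomogeneousOfType f a b m)
    (hf : HasIsolatedSingularityAtOrigin f) {ψ : ℝ × ℝ → ℝ} (hψ : IsFlat m ψ) {σ : ℝ}
    (hσ : -1 < σ) : Integrable fun p : ℝ × ℝ => |ev f p.1 p.2| ^ σ * |ψ p| := by
  have hc := continuous_ev f
  have hmeas : Measurable fun p : ℝ × ℝ => |ev f p.1 p.2| ^ σ * |ψ p| :=
    (hc.measurable.abs.pow_const σ).mul hψ.1.abs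
  have h1 := hψ.lintegral_region_lt_top (g := ev f) hc.measurable ha hb h hσ
    fun ε hε => integrableOn_abs_ev_right ha hb h hf hσ hε
  have hc2 : Measurable fun p : ℝ × ℝ => ev f p.2 p.1 := (hc.comp continuous_swap).measurable
  have hom : ∀ t x y : ℝ, ev f (t ^ a * y) (t ^ b * x) = t ^ m * ev f y x := fun t x y => h t y x
  have h2 := hψ.swap.lintegral_region_lt_top (g := fun x y => ev f y x) hc2 hb ha hom hσ
    fun ε hε => integrableOn_abs_ev_left ha hb h hf hσ hε
  have h3 : ∫⁻ p : ℝ × ℝ in {p | |p.1| ^ b ≤ |p.2| ^ a},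
      ENNReal.ofReal (|ev f p.1 p.2| ^ σ * |ψ p|) < ⊤ := by
    have hmp : MeasurePreserving (Prod.swap : ℝ × ℝ → ℝ × ℝ) volume volume :=
      Measure.measurePreserving_swap
    have := hmp.setLIntegral_comp_preimage_emb MeasurableEquiv.prodComm.measurableEmbedding
      (fun p : ℝ × ℝ => ENNReal.ofReal (|ev f p.1 p.2| ^ σ * |ψ p|))
      {p | |p.1| ^ b ≤ |p.2| ^ a}
    rw [← this]
    simpa only [preimage_ofPred_eq, Prod.fst_swap, Prod.snd_swap] using h2
  refine ⟨hmeas.aestronglyMeasurable, ?_⟩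
  rw [hasFiniteIntegral_iff_ofReal (Eventually.of_forall fun p => by positivity)]
  have hU : ({p | |p.2| ^ a ≤ |p.1| ^ b} ∪ {p | |p.1| ^ b ≤ |p.2| ^ a} : Set (ℝ × ℝ)) = univ := by
    ext p
    simp [le_total]
  rw [← setLIntegral_univ, ← hU]
  exact (lintegral_union_le _ _ _).trans_lt (ENNReal.add_lt_top.2 ⟨h1, h3⟩)

end RealZeta

namespace RealZeta

open MeasureTheory Set Filter Topology MvPolynomial

variable {f : MvPolynomial (Fin 2) ℝ} {a b m : ℕ}

/-! ### Zeta integrals of flat functions -/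

theorem ofReal_abs_cpow_eq_exp {t : ℝ} (ht : t ≠ 0) (s : ℂ) :
    ((|t| : ℝ) : ℂ) ^ s = Complex.exp (s * (Real.log |t| : ℝ)) := by
  rw [Complex.cpow_def_of_ne_zero (by simpa using ht), mul_comm,
    Complex.ofReal_log (abs_nonneg t)]

/-- For `ψ ≥ 0` the integral is the complex moment generating function of `log |f|` for the measure
`ψ dx dy` on `f ≠ 0`. Such a function is analytic wherever `Re s` is interior to the set of
exponents of integrability, and that set contains every `σ > -1`. -/
theorem IsFlat.exists_analytic_of_nonneg (ha : 0 < a) (hb : 0 < b)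
    (h : IsWeightedHomogeneousOfType f a b m) (hf : HasIsolatedSingularityAtOrigin f)
    {ψ : ℝ × ℝ → ℝ} (hψ : IsFlat m ψ) (hψ0 : ∀ p, 0 ≤ ψ p) :
    ∃ G : ℂ → ℂ, AnalyticOnNhd ℂ G {s : ℂ | -1 < s.re} ∧
      ∀ s : ℂ, 0 < s.re → G s = zetaIntegral f ψ s := by
  have hc := continuous_ev f
  set S : Set (ℝ × ℝ) := {p | ev f p.1 p.2 ≠ 0} with hS
  have hSm : MeasurableSet S := (hc.measurable (measurableSet_singleton 0)).compl
  set X : ℝ × ℝ → ℝ := fun p => Real.log |ev f p.1 p.2| with hX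
  set μ : Measure (ℝ × ℝ) := (volume.restrict S).withDensity fun p => ENNReal.ofReal (ψ p) with hμ
  have hmeas : Measurable fun p => ENNReal.ofReal (ψ p) := hψ.1.ennreal_ofReal
  have hfin : ∀ᵐ p ∂(volume.restrict S), ENNReal.ofReal (ψ p) < ⊤ :=
    Eventually.of_forall fun p => ENNReal.ofReal_lt_top
  refine ⟨ProbabilityTheory.complexMGF X μ, ?_, fun s hs => ?_⟩
  · refine ProbabilityTheory.analyticOnNhd_complexMGF.mono fun s hs => ?_
    have hsub : Ioi (-1 : ℝ) ⊆ ProbabilityTheory.integrableExpSet X μ := by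
      intro σ hσ
      change Integrable (fun p => Real.exp (σ * X p)) μ
      rw [hμ, integrable_withDensity_iff_integrable_smul' hmeas hfin]
      refine ((hψ.integrable ha hb h hf hσ).restrict (s := S)).congr ?_
      filter_upwards [ae_restrict_mem hSm] with p hp
      have hp' : 0 < |ev f p.1 p.2| := abs_pos.2 hp
      rw [ENNReal.toReal_ofReal (hψ0 p), smul_eq_mul, abs_of_nonneg (hψ0 p),
        Real.rpow_def_of_pos hp', mul_comm, mul_comm σ]
    exact interior_mono hsub (by rw [isOpen_Ioi.interior_eq]; exact hs)
  -- Discarding the curve `f = 0` does not change the integral, because `0 ^ s = 0` for `s ≠ 0`.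
  · have hs0 : s ≠ 0 := by
      rintro rfl
      simp at hs
    rw [ProbabilityTheory.complexMGF, hμ, integral_withDensity_eq_integral_toReal_smul hmeas hfin,
      zetaIntegral, ← integral_indicator hSm]
    refine integral_congr_ae (Eventually.of_forall fun p => ?_)
    simp only
    by_cases hp : p ∈ S
    · rw [indicator_of_mem hp, ofReal_abs_cpow_eq_exp hp, ENNReal.toReal_ofReal (hψ0 p),
        Complex.real_smul, mul_comm]
    · rw [indicator_of_notMem hp]
      have : ev f p.1 p.2 = 0 := not_not.1 hp
      simp [this, Complex.zero_cpow hs0]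

/-- Bounded measurable functions of bounded support on the plane. -/
def IsBoundedWithBoundedSupport (ψ : ℝ × ℝ → ℝ) : Prop :=
  Measurable ψ ∧ ∃ C R : ℝ, ∀ p : ℝ × ℝ, |ψ p| ≤ C ∧ (R < |p.1| ∨ R < |p.2| → ψ p = 0)

theorem IsBoundedWithBoundedSupport.integrable (f : MvPolynomial (Fin 2) ℝ) {ψ : ℝ × ℝ → ℝ}
    (hψ : IsBoundedWithBoundedSupport ψ) {s : ℂ} (hs : 0 < s.re) :
    Integrable fun p : ℝ × ℝ => ((|ev f p.1 p.2| : ℝ) : ℂ) ^ s * (ψ p : ℂ) := by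
  obtain ⟨hm, C, R, hψ⟩ := hψ
  have hc := continuous_ev f
  have hc' : Continuous fun p : ℝ × ℝ => |ev f p.1 p.2| ^ s.re * C :=
    (hc.abs.rpow_const fun _ => Or.inr hs.le).mul continuous_const
  have hint : IntegrableOn (fun p : ℝ × ℝ => |ev f p.1 p.2| ^ s.re * C)
      (Icc (-R) R ×ˢ Icc (-R) R) :=
    hc'.continuousOn.integrableOn_compact (isCompact_Icc.prod isCompact_Icc)
  have hbox : MeasurableSet (Icc (-R) R ×ˢ Icc (-R) R) := measurableSet_Icc.prod measurableSet_Icc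
  refine Integrable.mono' ((integrable_indicator_iff hbox).2 hint) ?_ (Eventually.of_forall fun p => ?_)
  · have h1 : Measurable fun p : ℝ × ℝ => ((|ev f p.1 p.2| : ℝ) : ℂ) ^ s :=
      (Complex.measurable_ofReal.comp hc.measurable.abs).pow_const s
    exact (h1.mul (Complex.measurable_ofReal.comp hm)).aestronglyMeasurable
  · by_cases hp : p ∈ Icc (-R) R ×ˢ Icc (-R) R
    · rw [indicator_of_mem hp, norm_mul, Complex.norm_cpow_eq_rpow_re_of_nonneg (abs_nonneg _) hs.ne',
        Complex.norm_real]
      exact mul_le_mul_of_nonneg_left (hψ p).1 (by positivity)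
    · have : ψ p = 0 := (hψ p).2 (by
        by_contra! hcon
        exact hp ⟨abs_le.1 hcon.1, abs_le.1 hcon.2⟩)
      rw [this, indicator_of_notMem hp]
      simp

theorem zetaIntegral_add (f : MvPolynomial (Fin 2) ℝ) {ψ χ : ℝ × ℝ → ℝ}
    (hψ : IsBoundedWithBoundedSupport ψ) (hχ : IsBoundedWithBoundedSupport χ) {s : ℂ}
    (hs : 0 < s.re) :
    zetaIntegral f (fun p => ψ p + χ p) s = zetaIntegral f ψ s + zetaIntegral f χ s := by
  unfold zetaIntegral
  rw [← integral_add (hψ.integrable f hs) (hχ.integrable f hs)]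
  congr 1
  ext p
  push_cast
  ring

theorem zetaIntegral_const_mul (f : MvPolynomial (Fin 2) ℝ) (ψ : ℝ × ℝ → ℝ) (c : ℝ) (s : ℂ) :
    zetaIntegral f (fun p => c * ψ p) s = c * zetaIntegral f ψ s := by
  unfold zetaIntegral
  rw [← integral_const_mul]
  congr 1
  ext p
  push_cast
  ring

theorem IsBoundedWithBoundedSupport.zero : IsBoundedWithBoundedSupport fun _ => 0 :=
  ⟨measurable_const, 0, 0, fun p => by simp⟩

theorem IsBoundedWithBoundedSupport.add {ψ χ : ℝ × ℝ → ℝ}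
    (hψ : IsBoundedWithBoundedSupport ψ) (hχ : IsBoundedWithBoundedSupport χ) :
    IsBoundedWithBoundedSupport fun p => ψ p + χ p := by
  obtain ⟨hm, C, R, h⟩ := hψ
  obtain ⟨hm', C', R', h'⟩ := hχ
  refine ⟨hm.add hm', C + C', max R R', fun p => ⟨(abs_add_le _ _).trans
    (add_le_add (h p).1 (h' p).1), fun hp => ?_⟩⟩
  beta_reduce
  rw [(h p).2, (h' p).2, add_zero]
  · exact hp.imp (le_max_right R R').trans_lt (le_max_right R R').trans_lt
  · exact hp.imp (le_max_left R R').trans_lt (le_max_left R R').trans_lt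

theorem IsBoundedWithBoundedSupport.const_mul {ψ : ℝ × ℝ → ℝ}
    (hψ : IsBoundedWithBoundedSupport ψ) (c : ℝ) :
    IsBoundedWithBoundedSupport fun p => c * ψ p := by
  obtain ⟨hm, C, R, h⟩ := hψ
  refine ⟨hm.const_mul c, |c| * C, R, fun p => ⟨?_, fun hp => by simp [(h p).2 hp]⟩⟩
  rw [abs_mul]
  exact mul_le_mul_of_nonneg_left (h p).1 (abs_nonneg c)

theorem IsBoundedWithBoundedSupport.sum {ι : Type*} (t : Finset ι) {ψ : ι → ℝ × ℝ → ℝ}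
    (hψ : ∀ i ∈ t, IsBoundedWithBoundedSupport (ψ i)) :
    IsBoundedWithBoundedSupport fun p => ∑ i ∈ t, ψ i p := by
  classical
  induction t using Finset.induction_on with
  | empty => simpa using IsBoundedWithBoundedSupport.zero
  | insert i t hi ih =>
    simp only [Finset.sum_insert hi]
    exact (hψ i (Finset.mem_insert_self i t)).add
      (ih fun j hj => hψ j (Finset.mem_insert_of_mem hj))

theorem zetaIntegral_sum (f : MvPolynomial (Fin 2) ℝ) {ι : Type*} (t : Finset ι)
    {ψ : ι → ℝ × ℝ → ℝ} (hψ : ∀ i ∈ t, IsBoundedWithBoundedSupport (ψ i)) {s : ℂ}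
    (hs : 0 < s.re) :
    zetaIntegral f (fun p => ∑ i ∈ t, ψ i p) s = ∑ i ∈ t, zetaIntegral f (ψ i) s := by
  unfold zetaIntegral
  rw [← integral_finsetSum _ fun i hi => (hψ i hi).integrable f hs]
  congr 1
  ext p
  push_cast
  rw [Finset.mul_sum]

theorem IsFlat.isBoundedWithBoundedSupport {ψ : ℝ × ℝ → ℝ} (hψ : IsFlat m ψ) :
    IsBoundedWithBoundedSupport ψ := by
  obtain ⟨hm, C, R, hC, hR, h⟩ := hψ
  refine ⟨hm, C * (R ^ m + R ^ m), R, fun p => ⟨?_, (h p).2⟩⟩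
  by_cases hp : R < |p.1| ∨ R < |p.2|
  · rw [(h p).2 hp, abs_zero]
    positivity
  · push Not at hp
    refine (h p).1.trans ?_
    gcongr
    · exact hp.1
    · exact hp.2

theorem IsFlat.mono {ψ χ : ℝ × ℝ → ℝ} (hψ : IsFlat m ψ) (hχ : Measurable χ)
    (hle : ∀ p, |χ p| ≤ |ψ p|) : IsFlat m χ := by
  obtain ⟨hm, C, R, hC, hR, h⟩ := hψ
  refine ⟨hχ, C, R, hC, hR, fun p => ⟨(hle p).trans (h p).1, fun hp => ?_⟩⟩
  have := hle p
  rw [(h p).2 hp, abs_zero] at this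
  exact abs_nonpos_iff.1 this

/-- The zeta integral of a flat function has no poles in `Re s > -1`. -/
theorem IsFlat.exists_analytic (ha : 0 < a) (hb : 0 < b)
    (h : IsWeightedHomogeneousOfType f a b m) (hf : HasIsolatedSingularityAtOrigin f)
    {ψ : ℝ × ℝ → ℝ} (hψ : IsFlat m ψ) :
    ∃ G : ℂ → ℂ, AnalyticOnNhd ℂ G {s : ℂ | -1 < s.re} ∧
      ∀ s : ℂ, 0 < s.re → G s = zetaIntegral f ψ s := by
  -- The positive and negative parts of `ψ` are flat, and each defines a measure.
  have h1 : IsFlat m fun p => max (ψ p) 0 :=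
    hψ.mono (hψ.1.max measurable_const) fun p => by
      rw [abs_of_nonneg (le_max_right _ _)]
      exact max_le (le_abs_self _) (abs_nonneg _)
  have h2 : IsFlat m fun p => max (-ψ p) 0 :=
    hψ.mono (hψ.1.neg.max measurable_const) fun p => by
      rw [abs_of_nonneg (le_max_right _ _)]
      exact max_le (neg_le_abs _) (abs_nonneg _)
  obtain ⟨G₁, hG₁, hG₁'⟩ := h1.exists_analytic_of_nonneg ha hb h hf fun p => le_max_right _ _
  obtain ⟨G₂, hG₂, hG₂'⟩ := h2.exists_analytic_of_nonneg ha hb h hf fun p => le_max_right _ _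
  refine ⟨fun s => G₁ s + ((-1 : ℝ) : ℂ) * G₂ s,
    fun s hs => (hG₁ s hs).add (analyticAt_const.mul (hG₂ s hs)), fun s hs => ?_⟩
  simp only
  rw [hG₁' s hs, hG₂' s hs, ← zetaIntegral_const_mul, ← zetaIntegral_add f
    h1.isBoundedWithBoundedSupport (h2.isBoundedWithBoundedSupport.const_mul (-1)) hs]
  congr 1
  ext p
  rcases le_total 0 (ψ p) with hp | hp <;> simp [hp]

/-! ### Truncated monomials -/

/-- The monomial `x ^ i * y ^ j`, truncated to the square `|x|, |y| ≤ 1`. -/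
noncomputable def truncatedMonomial (i j : ℕ) (p : ℝ × ℝ) : ℝ :=
  (Icc (-1 : ℝ) 1 ×ˢ Icc (-1 : ℝ) 1).indicator (fun p => p.1 ^ i * p.2 ^ j) p

theorem measurable_truncatedMonomial (i j : ℕ) : Measurable (truncatedMonomial i j) := by
  have : Measurable fun p : ℝ × ℝ => p.1 ^ i * p.2 ^ j := by fun_prop
  exact this.indicator (measurableSet_Icc.prod measurableSet_Icc)

theorem abs_truncatedMonomial_le (i j : ℕ) (p : ℝ × ℝ) : |truncatedMonomial i j p| ≤ 1 := by
  unfold truncatedMonomial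
  by_cases hp : p ∈ Icc (-1 : ℝ) 1 ×ˢ Icc (-1 : ℝ) 1
  · rw [indicator_of_mem hp, abs_mul, abs_pow, abs_pow]
    exact mul_le_one₀ (pow_le_one₀ (abs_nonneg _) (abs_le.2 hp.1)) (by positivity)
      (pow_le_one₀ (abs_nonneg _) (abs_le.2 hp.2))
  · rw [indicator_of_notMem hp]
    simp

theorem truncatedMonomial_eq_zero (i j : ℕ) {p : ℝ × ℝ} (hp : 1 < |p.1| ∨ 1 < |p.2|) :
    truncatedMonomial i j p = 0 := by
  refine indicator_of_notMem (fun h => ?_) _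
  exact hp.elim (fun h' => h'.not_ge (abs_le.2 h.1)) (fun h' => h'.not_ge (abs_le.2 h.2))

theorem isBoundedWithBoundedSupport_truncatedMonomial (i j : ℕ) :
    IsBoundedWithBoundedSupport (truncatedMonomial i j) :=
  ⟨measurable_truncatedMonomial i j, 1, 1, fun p =>
    ⟨abs_truncatedMonomial_le i j p, truncatedMonomial_eq_zero i j⟩⟩

theorem integral_comp_diag {u v : ℝ} (hu : u ≠ 0) (hv : v ≠ 0) (F : ℝ × ℝ → ℂ) :
    ∫ p : ℝ × ℝ, F (u * p.1, v * p.2) = ((|u|⁻¹ * |v|⁻¹ : ℝ) : ℂ) * ∫ p, F p := by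
  have hmap : Measure.map (Prod.map (fun x : ℝ => u * x) fun y : ℝ => v * y) volume =
      (ENNReal.ofReal |u⁻¹| * ENNReal.ofReal |v⁻¹|) • (volume : Measure (ℝ × ℝ)) := by
    rw [Measure.volume_eq_prod, ← Measure.map_prod_map _ _ (by fun_prop) (by fun_prop),
      Real.map_volume_mul_left hu, Real.map_volume_mul_left hv, Measure.prod_smul_left,
      Measure.prod_smul_right, smul_smul]
  have hemb : MeasurableEmbedding (Prod.map (fun x : ℝ => u * x) fun y : ℝ => v * y) :=
    ((Homeomorph.mulLeft₀ u hu).prodCongr (Homeomorph.mulLeft₀ v hv)).measurableEmbedding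
  have := hemb.integral_map (μ := volume) F
  rw [hmap, integral_smul_measure] at this
  simp only [Prod.map] at this
  rw [← this, ENNReal.toReal_mul, ENNReal.toReal_ofReal (abs_nonneg _),
    ENNReal.toReal_ofReal (abs_nonneg _), abs_inv, abs_inv, Complex.real_smul]

/-- The truncated monomial restricted to the complement of the square `|x| ≤ 2⁻ᵃ, |y| ≤ 2⁻ᵇ`. -/
theorem isFlat_truncatedMonomial_sub (a b m i j : ℕ) :
    IsFlat m fun p => truncatedMonomial i j p +
      (-(2 ^ (i * a + j * b))⁻¹ : ℝ) * truncatedMonomial i j (2 ^ a * p.1, 2 ^ b * p.2) := by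
  have hm : Measurable fun p : ℝ × ℝ => ((2 ^ a * p.1, 2 ^ b * p.2) : ℝ × ℝ) := by fun_prop
  refine ⟨(measurable_truncatedMonomial i j).add
    (((measurable_truncatedMonomial i j).comp hm).const_mul _), 2 * 2 ^ ((a + b) * m), 1,
    by positivity, le_rfl, fun p => ?_⟩
  beta_reduce
  have h2a : (1 : ℝ) ≤ 2 ^ a := one_le_pow₀ one_le_two
  have h2b : (1 : ℝ) ≤ 2 ^ b := one_le_pow₀ one_le_two
  have hmul : ∀ {c x : ℝ}, 1 ≤ c → |x| ≤ |c * x| := fun {c x} hc => by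
    rw [abs_mul]
    exact le_mul_of_one_le_left (abs_nonneg x) (hc.trans (le_abs_self c))
  refine ⟨?_, fun hp => ?_⟩
  · by_cases hp : 1 < |2 ^ a * p.1| ∨ 1 < |2 ^ b * p.2|
    · rw [truncatedMonomial_eq_zero i j (p := (2 ^ a * p.1, 2 ^ b * p.2)) hp, mul_zero, add_zero]
      refine (abs_truncatedMonomial_le i j p).trans ?_
      have hx : (0 : ℝ) ≤ |p.1| ^ m := by positivity
      have hy : (0 : ℝ) ≤ |p.2| ^ m := by positivity
      -- Off the small square one coordinate is bounded below, so the constant `2 ^ ((a + b) * m)`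
      -- outweighs its `m`-th power. Flatness restricts a bounded function only near the origin.
      have hkey : ∀ {x : ℝ} {k : ℕ}, k ≤ a + b → 1 < |2 ^ k * x| →
          1 ≤ 2 ^ ((a + b) * m) * |x| ^ m := by
        intro x k hk hx
        rw [pow_mul, ← mul_pow]
        refine one_le_pow₀ (hx.le.trans ?_)
        rw [abs_mul, abs_of_pos (by positivity)]
        gcongr
        norm_num
      have hpos : (0 : ℝ) < 2 ^ ((a + b) * m) := by positivity
      rcases hp with hp | hp
      · nlinarith [hkey (Nat.le_add_right a b) hp, mul_nonneg hpos.le hx, mul_nonneg hpos.le hy]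
      · nlinarith [hkey (Nat.le_add_left b a) hp, mul_nonneg hpos.le hx, mul_nonneg hpos.le hy]
    · push Not at hp
      have h1 : p ∈ Icc (-1 : ℝ) 1 ×ˢ Icc (-1 : ℝ) 1 :=
        ⟨abs_le.1 ((hmul h2a).trans hp.1), abs_le.1 ((hmul h2b).trans hp.2)⟩
      have h2 : ((2 ^ a * p.1, 2 ^ b * p.2) : ℝ × ℝ) ∈ Icc (-1 : ℝ) 1 ×ˢ Icc (-1 : ℝ) 1 :=
        ⟨abs_le.1 hp.1, abs_le.1 hp.2⟩
      -- On the small square both cut-offs are inactive, and the dilated monomial is exactly `2 ^ (i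
      -- * a + j * b)` times the original one.
      have : truncatedMonomial i j p +
          (-(2 ^ (i * a + j * b))⁻¹ : ℝ) * truncatedMonomial i j (2 ^ a * p.1, 2 ^ b * p.2) = 0 := by
        rw [truncatedMonomial, truncatedMonomial, indicator_of_mem h1, indicator_of_mem h2]
        simp only [mul_pow, ← pow_mul]
        rw [pow_add, mul_comm i a, mul_comm j b]
        field_simp
        ring
      rw [this, abs_zero]
      positivity
  · rw [truncatedMonomial_eq_zero i j hp, truncatedMonomial_eq_zero i j (p := (2 ^ a * p.1, 2 ^ b * p.2))]
    · simp
    · exact hp.imp (fun h => h.trans_le (hmul h2a)) (fun h => h.trans_le (hmul h2b))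

/-- Under this dilation `|f| ^ s` gains the factor `2 ^ (m * s)`, and the Jacobian accounts for `2 ^
(-(a + b))`. -/
theorem zetaIntegral_comp_scale (h : IsWeightedHomogeneousOfType f a b m) (ψ : ℝ × ℝ → ℝ) (s : ℂ) :
    zetaIntegral f (fun p => ψ (2 ^ a * p.1, 2 ^ b * p.2)) s =
      (2 : ℂ) ^ (-(m * s + a + b)) * zetaIntegral f ψ s := by
  have h2 := integral_comp_diag (u := 2 ^ a) (v := 2 ^ b) (by positivity) (by positivity)
    fun p => ((|ev f p.1 p.2| : ℝ) : ℂ) ^ s * (ψ p : ℂ)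
  have h3 : ∀ p : ℝ × ℝ, ((|ev f (2 ^ a * p.1) (2 ^ b * p.2)| : ℝ) : ℂ) ^ s =
      (2 : ℂ) ^ (m * s) * ((|ev f p.1 p.2| : ℝ) : ℂ) ^ s := by
    intro p
    rw [h 2 p.1 p.2, abs_mul, Complex.ofReal_mul,
      Complex.mul_cpow_ofReal_nonneg (abs_nonneg _) (abs_nonneg _), abs_of_pos (by positivity),
      Complex.ofReal_pow, Complex.ofReal_ofNat]
    congr 1
    exact_mod_cast (Complex.natCast_cpow_natCast_mul 2 m s).symm
  simp only [h3] at h2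
  unfold zetaIntegral
  simp only [mul_assoc] at h2
  rw [integral_const_mul] at h2
  rw [neg_add, neg_add, Complex.cpow_add _ _ two_ne_zero, Complex.cpow_add _ _ two_ne_zero,
    Complex.cpow_neg, Complex.cpow_neg, Complex.cpow_neg, Complex.cpow_natCast,
    Complex.cpow_natCast]
  have hne : (2 : ℂ) ^ (m * s) ≠ 0 := by simp [Complex.cpow_eq_zero_iff]
  rw [mul_assoc, mul_assoc, inv_mul_eq_div, eq_div_iff hne, mul_comm, h2]
  simp [abs_of_pos, mul_assoc]

theorem neg_one_lt_re_neg_div {d m : ℕ} (hd : d < m) : -1 < (-(d : ℂ) / m).re := by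
  rw [show -(d : ℂ) / m = ((-(d / m : ℝ) : ℝ) : ℂ) by push_cast; ring, Complex.ofReal_re,
    neg_lt_neg_iff, div_lt_one (by exact_mod_cast (by omega : 0 < m))]
  exact_mod_cast hd

/-- The monomial minus its rescaled dilate is flat, so `E * I = H` with `H` analytic and `E` entire,
and `H / E` continues `I`. One function `G` serves all `d` simultaneously. -/
theorem exists_meromorphic_truncatedMonomial (ha : 0 < a) (hb : 0 < b)
    (h : IsWeightedHomogeneousOfType f a b m) (hf : HasIsolatedSingularityAtOrigin f) (i j : ℕ) :
    ∃ G : ℂ → ℂ, MeromorphicOn G {s : ℂ | -1 < s.re} ∧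
      (∀ s : ℂ, 0 < s.re → G s = zetaIntegral f (truncatedMonomial i j) s) ∧
      ∀ d : ℕ, d < m →
        (d = (i + 1) * a + (j + 1) * b →
          ∀ s : ℂ, 0 < s.re → zetaIntegral f (truncatedMonomial i j) s = 0) →
        AnalyticAt ℂ G (-(d : ℂ) / m) := by
  -- If the integral vanishes identically, the zero function is the continuation. Otherwise the
  -- vanishing hypothesis on `d` rules out `d = (i + 1) * a + (j + 1) * b`, so `E` is nonzero at `-d
  -- / m`.
  by_cases hz : ∀ s : ℂ, 0 < s.re → zetaIntegral f (truncatedMonomial i j) s = 0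
  · exact ⟨fun _ => 0, fun s _ => analyticAt_const.meromorphicAt, fun s hs => (hz s hs).symm,
      fun d _ _ => analyticAt_const⟩
  obtain ⟨H, hH, hH'⟩ := (isFlat_truncatedMonomial_sub a b m i j).exists_analytic ha hb h hf
  set E : ℂ → ℂ := fun s => 1 - (2 ^ (i * a + j * b))⁻¹ * (2 : ℂ) ^ (-(m * s + a + b)) with hE
  have hEd : Differentiable ℂ E := by
    have : Differentiable ℂ fun s : ℂ => (2 : ℂ) ^ (-(m * s + a + b)) := by
      refine Differentiable.const_cpow (by fun_prop) (Or.inl two_ne_zero)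
    exact (differentiable_const _).sub (this.const_mul _)
  have hEa : ∀ s, AnalyticAt ℂ E s := fun s => hEd.analyticAt s
  refine ⟨fun s => H s / E s, fun s hs => (hH s hs).meromorphicAt.div (hEa s).meromorphicAt,
    fun s hs => ?_, fun d hd hzero => ?_⟩
  · have hEne : E s ≠ 0 := by
      intro h0
      have h1 : (2 ^ (i * a + j * b))⁻¹ * (2 : ℂ) ^ (-(m * s + a + b)) = 1 := (sub_eq_zero.1 h0).symm
      have h2 := congrArg norm h1
      rw [norm_mul, norm_inv, norm_pow, Complex.norm_ofNat, norm_one,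
        show (2 : ℂ) = ((2 : ℝ) : ℂ) by simp, Complex.norm_cpow_eq_rpow_re_of_pos two_pos] at h2
      have h3 : (2 : ℝ) ^ (-((m : ℂ) * s + a + b)).re < 1 := by
        refine Real.rpow_lt_one_of_one_lt_of_neg one_lt_two ?_
        simp only [Complex.neg_re, Complex.add_re, Complex.mul_re, Complex.natCast_re,
          Complex.natCast_im, zero_mul, sub_zero]
        have : 0 ≤ (m : ℝ) * s.re := by positivity
        have : (0 : ℝ) < a := by exact_mod_cast ha
        have : (0 : ℝ) < b := by exact_mod_cast hb
        linarith
      have h4 : ((2 : ℝ) ^ (i * a + j * b))⁻¹ ≤ 1 := inv_le_one_of_one_le₀ (one_le_pow₀ one_le_two)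
      have h5 : (0 : ℝ) < ((2 : ℝ) ^ (i * a + j * b))⁻¹ := by positivity
      nlinarith
    have hm : Measurable fun p : ℝ × ℝ => ((2 ^ a * p.1, 2 ^ b * p.2) : ℝ × ℝ) := by fun_prop
    have hbd : IsBoundedWithBoundedSupport fun p =>
        truncatedMonomial i j (2 ^ a * p.1, 2 ^ b * p.2) := by
      refine ⟨(measurable_truncatedMonomial i j).comp hm, 1, 1, fun p =>
        ⟨abs_truncatedMonomial_le i j _, fun hp => truncatedMonomial_eq_zero i j ?_⟩⟩
      have hmul : ∀ (k : ℕ) (x : ℝ), |x| ≤ |2 ^ k * x| := fun k x => by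
        rw [abs_mul, abs_of_pos (by positivity : (0 : ℝ) < 2 ^ k)]
        exact le_mul_of_one_le_left (abs_nonneg x) (one_le_pow₀ one_le_two)
      exact hp.imp (fun h => h.trans_le (hmul a _)) (fun h => h.trans_le (hmul b _))
    beta_reduce
    rw [hH' s hs, div_eq_iff hEne, zetaIntegral_add f
      (isBoundedWithBoundedSupport_truncatedMonomial i j) (hbd.const_mul _) hs,
      zetaIntegral_const_mul, zetaIntegral_comp_scale h, hE]
    push_cast
    ring
  · have hm0 : (m : ℂ) ≠ 0 := by
      have : m ≠ 0 := by omega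
      exact_mod_cast this
    refine (hH _ (neg_one_lt_re_neg_div hd)).div (hEa _) fun h0 => hz (hzero ?_)
    have h1 : (2 ^ (i * a + j * b))⁻¹ * (2 : ℂ) ^ (-(m * (-(d : ℂ) / m) + a + b)) = 1 :=
      (sub_eq_zero.1 h0).symm
    rw [mul_div_cancel₀ _ hm0, show -(-(d : ℂ) + a + b) = d - a - b by ring,
      Complex.cpow_sub _ _ two_ne_zero, Complex.cpow_sub _ _ two_ne_zero, Complex.cpow_natCast,
      Complex.cpow_natCast, Complex.cpow_natCast] at h1
    field_simp at h1
    rw [← pow_add, ← pow_add] at h1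
    have h2 := Nat.pow_right_injective le_rfl (by exact_mod_cast h1 : (2 : ℕ) ^ d = 2 ^ _)
    rw [h2]
    ring

/-! ### Taylor expansion -/

/-- Write `p = x e₁ + y e₂` and expand by multilinearity over the set of slots that receive `e₁`. -/
theorem exists_ev_eq_multilinear {k : ℕ} (L : (ℝ × ℝ) [×k]→L[ℝ] ℝ) :
    ∃ P : MvPolynomial (Fin 2) ℝ, ∀ p : ℝ × ℝ, L (fun _ => p) = ev P p.1 p.2 := by
  classical
  refine ⟨∑ s : Finset (Fin k), X 0 ^ s.card * X 1 ^ sᶜ.card *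
    C (L (s.piecewise (fun _ => (1, 0)) fun _ => (0, 1))), fun p => ?_⟩
  have hp : (fun _ : Fin k => p) = (fun _ => p.1 • ((1, 0) : ℝ × ℝ)) +
      fun _ => p.2 • ((0, 1) : ℝ × ℝ) := by
    ext <;> simp
  have h1 := L.toMultilinearMap.map_add_univ (fun _ => p.1 • ((1, 0) : ℝ × ℝ))
      fun _ => p.2 • ((0, 1) : ℝ × ℝ)
  rw [← hp] at h1
  simp only [ContinuousMultilinearMap.coe_coe] at h1
  rw [h1, ev, map_sum]
  refine Finset.sum_congr rfl fun s _ => ?_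
  have h2 := L.toMultilinearMap.map_smul_univ (fun t => if t ∈ s then p.1 else p.2)
    (s.piecewise (fun _ => ((1, 0) : ℝ × ℝ)) fun _ => (0, 1))
  have h3 : (fun t => (if t ∈ s then p.1 else p.2) •
      (s.piecewise (fun _ => ((1, 0) : ℝ × ℝ)) fun _ => (0, 1)) t) =
      s.piecewise (fun _ => p.1 • ((1, 0) : ℝ × ℝ)) fun _ => p.2 • ((0, 1) : ℝ × ℝ) := by
    ext t <;> by_cases ht : t ∈ s <;> simp [Finset.piecewise, ht]
  rw [h3] at h2
  simp only [ContinuousMultilinearMap.coe_coe] at h2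
  rw [h2, Finset.prod_ite, Finset.prod_const, Finset.prod_const]
  simp [Finset.filter_not, Finset.compl_eq_univ_sdiff]

/-- The one-variable Taylor formula is applied to `τ ↦ φ (τ • p)` on `[0, 1]`. Its `k`-th derivative
is the `k`-th Fréchet derivative of `φ` evaluated on copies of `p`, so the last one is `O(‖p‖ ^ (n +
1))` uniformly on the unit ball. -/
theorem exists_taylor_polynomial {φ : ℝ × ℝ → ℝ} (hφ : ContDiff ℝ ∞ φ) (n : ℕ) :
    ∃ P : MvPolynomial (Fin 2) ℝ, ∃ C : ℝ, 0 ≤ C ∧ ∀ p : ℝ × ℝ, ‖p‖ ≤ 1 →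
      |φ p - ev P p.1 p.2| ≤ C * ‖p‖ ^ (n + 1) := by
  have hline : ∀ (p : ℝ × ℝ) (k : ℕ) (t : ℝ), iteratedDeriv k (fun τ : ℝ => φ (τ • p)) t =
      iteratedFDeriv ℝ k φ (t • p) fun _ => p := by
    intro p k t
    have := (ContinuousLinearMap.toSpanSingleton ℝ p).iteratedFDeriv_comp_right hφ t
      (i := k) (by exact_mod_cast le_top)
    rw [iteratedDeriv_eq_iteratedFDeriv]
    have h2 : (fun τ : ℝ => φ (τ • p)) = φ ∘ ContinuousLinearMap.toSpanSingleton ℝ p := by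
      ext τ
      simp
    rw [h2, this]
    simp
  have hcont : Continuous fun p => ‖iteratedFDeriv ℝ (n + 1) φ p‖ :=
    (hφ.continuous_iteratedFDeriv (by exact_mod_cast le_top)).norm
  obtain ⟨M, hM⟩ := (isCompact_closedBall (0 : ℝ × ℝ) 1).bddAbove_image hcont.continuousOn
  have hM' : ∀ p : ℝ × ℝ, ‖p‖ ≤ 1 → ‖iteratedFDeriv ℝ (n + 1) φ p‖ ≤ M := fun p hp =>
    hM ⟨p, by simpa using hp, rfl⟩
  have hM0 : 0 ≤ M := (norm_nonneg _).trans (hM' 0 (by simp))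
  choose P hP using fun k => exists_ev_eq_multilinear (iteratedFDeriv ℝ k φ 0)
  refine ⟨∑ k ∈ Finset.range (n + 1), C ((k.factorial : ℝ)⁻¹) * P k, M / n.factorial,
    by positivity, fun p hp => ?_⟩
  have hsm : ContDiff ℝ ∞ fun τ : ℝ => φ (τ • p) := hφ.comp (by fun_prop)
  have hud : UniqueDiffOn ℝ (Icc (0 : ℝ) 1) := uniqueDiffOn_Icc zero_lt_one
  have hw : ∀ k, ∀ t ∈ Icc (0 : ℝ) 1, iteratedDerivWithin k (fun τ : ℝ => φ (τ • p)) (Icc 0 1) t =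
      iteratedFDeriv ℝ k φ (t • p) fun _ => p := fun k t ht => by
    rw [iteratedDerivWithin_eq_iteratedDeriv hud
      ((hsm.of_le (by exact_mod_cast le_top)).contDiffAt) ht, hline]
  have := taylor_mean_remainder_bound (f := fun τ : ℝ => φ (τ • p)) (a := 0) (b := 1) (x := 1)
    (n := n) (C := M * ‖p‖ ^ (n + 1)) zero_le_one
    ((hsm.of_le (by exact_mod_cast le_top)).contDiffOn) (by simp) (fun t ht => by
      rw [hw _ t ht]
      refine (ContinuousMultilinearMap.le_opNorm _ _).trans ?_
      rw [Finset.prod_const, Finset.card_univ, Fintype.card_fin]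
      refine mul_le_mul_of_nonneg_right (hM' _ ?_) (by positivity)
      rw [norm_smul, Real.norm_of_nonneg ht.1]
      exact mul_le_one₀ ht.2 (norm_nonneg _) hp)
  rw [taylor_within_apply] at this
  have hev : ev (∑ k ∈ Finset.range (n + 1), C ((k.factorial : ℝ)⁻¹) * P k) p.1 p.2 =
      ∑ k ∈ Finset.range (n + 1), ((k.factorial : ℝ)⁻¹ * (1 - 0) ^ k) •
        iteratedDerivWithin k (fun τ : ℝ => φ (τ • p)) (Icc 0 1) 0 := by
    rw [ev, map_sum]
    refine Finset.sum_congr rfl fun k _ => ?_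
    rw [hw k 0 (by simp), zero_smul, hP k]
    simp [ev]
  rw [hev]
  simp only [one_smul] at this
  refine this.trans (le_of_eq ?_)
  ring

/-! ### Meromorphic continuation -/

theorem exists_flat_decomposition {φ : ℝ × ℝ → ℝ} (hφ : IsTestFunction φ) (m : ℕ) :
    ∃ P : MvPolynomial (Fin 2) ℝ, ∃ ψ : ℝ × ℝ → ℝ, IsFlat m ψ ∧ ∀ p, φ p = ψ p +
      ∑ u ∈ P.support, P.coeff u * truncatedMonomial (u 0) (u 1) p := by
  -- Order `m` leaves a remainder of order `m + 1`, one more than flatness asks, and avoids `m - 1`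
  -- when `m = 0`.
  obtain ⟨P, C, hC, hP⟩ := exists_taylor_polynomial hφ.1 m
  have hev : ∀ p ∈ Icc (-1 : ℝ) 1 ×ˢ Icc (-1 : ℝ) 1,
      ∑ u ∈ P.support, P.coeff u * truncatedMonomial (u 0) (u 1) p = ev P p.1 p.2 := by
    intro p hp
    rw [ev, eval_eq']
    refine Finset.sum_congr rfl fun u _ => ?_
    rw [truncatedMonomial, indicator_of_mem hp, Fin.prod_univ_two]
    simp
  have hev0 : ∀ p : ℝ × ℝ, 1 < |p.1| ∨ 1 < |p.2| →
      ∑ u ∈ P.support, P.coeff u * truncatedMonomial (u 0) (u 1) p = 0 := fun p hp =>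
    Finset.sum_eq_zero fun u _ => by rw [truncatedMonomial_eq_zero _ _ hp, mul_zero]
  obtain ⟨M, hM⟩ := hφ.2.exists_bound_of_continuous hφ.1.continuous
  have hM0 : 0 ≤ M := (norm_nonneg _).trans (hM 0)
  obtain ⟨R, hR⟩ := hφ.2.isCompact.isBounded.subset_closedBall (0 : ℝ × ℝ)
  refine ⟨P, fun p => φ p - ∑ u ∈ P.support, P.coeff u * truncatedMonomial (u 0) (u 1) p,
    ⟨?_, C + M, max R 1, by positivity, le_max_right _ _, fun p => ⟨?_, fun hp => ?_⟩⟩,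
    fun p => by ring⟩
  · exact hφ.1.continuous.measurable.sub (Finset.measurable_fun_sum _ fun u _ =>
      (measurable_truncatedMonomial _ _).const_mul _)
  · beta_reduce
    by_cases hp : 1 < |p.1| ∨ 1 < |p.2|
    · rw [hev0 p hp, sub_zero]
      have h1 : 1 ≤ |p.1| ^ m + |p.2| ^ m := by
        rcases hp with hp | hp
        · exact (one_le_pow₀ hp.le).trans (le_add_of_nonneg_right (by positivity))
        · exact (one_le_pow₀ hp.le).trans (le_add_of_nonneg_left (by positivity))
      calc |φ p| ≤ M := hM p
        _ ≤ C + M := by linarith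
        _ ≤ _ := le_mul_of_one_le_right (by positivity) h1
    · push Not at hp
      rw [hev p ⟨abs_le.1 hp.1, abs_le.1 hp.2⟩]
      have hn : ‖p‖ ≤ 1 := by simpa [Prod.norm_def] using hp
      refine (hP p hn).trans ?_
      have h1 : ‖p‖ ^ (m + 1) ≤ |p.1| ^ m + |p.2| ^ m := by
        refine (pow_le_pow_of_le_one (norm_nonneg _) hn (Nat.le_succ m)).trans ?_
        rw [Prod.norm_def, Real.norm_eq_abs, Real.norm_eq_abs]
        rcases max_cases |p.1| |p.2| with ⟨h, -⟩ | ⟨h, -⟩ <;> rw [h]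
        · exact le_add_of_nonneg_right (by positivity)
        · exact le_add_of_nonneg_left (by positivity)
      gcongr
      linarith
  · have hp1 : 1 < |p.1| ∨ 1 < |p.2| :=
      hp.imp (le_max_right R 1).trans_lt (le_max_right R 1).trans_lt
    have hpR : R < |p.1| ∨ R < |p.2| :=
      hp.imp (le_max_left R 1).trans_lt (le_max_left R 1).trans_lt
    have : φ p = 0 := by
      refine image_eq_zero_of_notMem_tsupport fun hmem => ?_
      have h1 := hR hmem
      rw [mem_closedBall_zero_iff, Prod.norm_def, max_le_iff] at h1
      exact hpR.elim (fun h => h.not_ge h1.1) (fun h => h.not_ge h1.2)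
    beta_reduce
    rw [this, hev0 p hp1, sub_zero]

theorem exists_continuation (ha : 0 < a) (hb : 0 < b)
    (h : IsWeightedHomogeneousOfType f a b m) (hf : HasIsolatedSingularityAtOrigin f)
    {φ : ℝ × ℝ → ℝ} (hφ : IsTestFunction φ) :
    ∃ G : ℂ → ℂ, IsZetaContinuation f φ G ∧
      ∀ d : ℕ, d < m →
        (∀ i j : ℕ, d = (i + 1) * a + (j + 1) * b →
          ∀ s : ℂ, 0 < s.re → zetaIntegral f (truncatedMonomial i j) s = 0) →
        AnalyticAt ℂ G (-(d : ℂ) / m) := by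
  obtain ⟨P, ψ, hψ, hdec⟩ := exists_flat_decomposition hφ m
  obtain ⟨H, hH, hH'⟩ := hψ.exists_analytic ha hb h hf
  choose G hG1 hG2 hG3 using exists_meromorphic_truncatedMonomial ha hb h hf
  refine ⟨fun s => H s + ∑ u ∈ P.support, ((P.coeff u : ℝ) : ℂ) * G (u 0) (u 1) s, ⟨?_, ?_⟩, ?_⟩
  · intro s hs
    refine (hH s hs).meromorphicAt.add (MeromorphicAt.fun_sum fun u _ => ?_)
    exact analyticAt_const.meromorphicAt.mul (hG1 _ _ s hs)
  · intro s hs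
    have hbd : ∀ u ∈ P.support, IsBoundedWithBoundedSupport
        fun p => P.coeff u * truncatedMonomial (u 0) (u 1) p := fun u _ =>
      (isBoundedWithBoundedSupport_truncatedMonomial _ _).const_mul _
    beta_reduce
    rw [funext hdec, zetaIntegral_add f hψ.isBoundedWithBoundedSupport
      (IsBoundedWithBoundedSupport.sum _ hbd) hs, hH' s hs, zetaIntegral_sum f _ hbd hs]
    congr 1
    refine Finset.sum_congr rfl fun u _ => ?_
    rw [zetaIntegral_const_mul, hG2 _ _ s hs]
  · intro d hd hzero
    refine (hH _ (neg_one_lt_re_neg_div hd)).add (Finset.analyticAt_fun_sum _ fun u _ => ?_)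
    exact analyticAt_const.mul (hG3 _ _ d hd (hzero _ _))

/-- Two continuations agree for `Re s > 0`, hence near every point of the connected half-plane apart
from the point itself. The existential in `IsZetaPole` is therefore independent of the choice of
continuation. -/
theorem IsZetaContinuation.meromorphicOrderAt_eq {φ : ℝ × ℝ → ℝ} {F G : ℂ → ℂ}
    (hF : IsZetaContinuation f φ F) (hG : IsZetaContinuation f φ G) {s : ℂ} (hs : -1 < s.re) :
    meromorphicOrderAt F s = meromorphicOrderAt G s := by
  have hd : MeromorphicOn (F - G) {s : ℂ | -1 < s.re} := hF.1.sub hG.1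
  have hconn : IsConnected {s : ℂ | -1 < s.re} :=
    ⟨⟨0, by simp⟩, (convex_halfSpace_re_gt (-1)).isPreconnected⟩
  have h1 : meromorphicOrderAt (F - G) 1 = ⊤ := by
    rw [meromorphicOrderAt_eq_top_iff]
    have : ∀ᶠ z in 𝓝 (1 : ℂ), 0 < z.re :=
      (isOpen_lt continuous_const Complex.continuous_re).mem_nhds (by simp)
    refine Filter.Eventually.filter_mono nhdsWithin_le_nhds ?_
    filter_upwards [this] with z hz
    simp [hF.2 z hz, hG.2 z hz]
  have h2 : meromorphicOrderAt (F - G) s = ⊤ := by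
    by_contra hne
    exact (hd.exists_meromorphicOrderAt_ne_top_iff_forall_mem hconn).1 ⟨s, hs, hne⟩ 1
      (by simp) h1
  rw [meromorphicOrderAt_eq_top_iff] at h2
  refine meromorphicOrderAt_congr ?_
  filter_upwards [h2] with z hz
  exact sub_eq_zero.1 hz

/-- If the truncated monomials that can contribute to `-d / m` have vanishing zeta integrals, then
`-d / m` is not a pole. -/
theorem not_isZetaPole (ha : 0 < a) (hb : 0 < b)
    (h : IsWeightedHomogeneousOfType f a b m) (hf : HasIsolatedSingularityAtOrigin f)
    {φ : ℝ × ℝ → ℝ} (hφ : IsTestFunction φ) {d : ℕ} (hd : d < m)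
    (hzero : ∀ i j : ℕ, d = (i + 1) * a + (j + 1) * b →
      ∀ s : ℂ, 0 < s.re → zetaIntegral f (truncatedMonomial i j) s = 0) :
    ¬ IsZetaPole f φ (-(d : ℂ) / m) := by
  rintro ⟨F, hF, hpole⟩
  obtain ⟨G, hG, hGa⟩ := exists_continuation ha hb h hf hφ
  rw [hF.meromorphicOrderAt_eq hG (neg_one_lt_re_neg_div hd)] at hpole
  exact hpole.not_ge (hGa d hd hzero).meromorphicOrderAt_nonneg

/-- The reflection `(x, y) ↦ (u x, v y)` preserves the measure, the square and `|f|`, and negates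
the monomial, so the integral equals its own negative. -/
theorem zetaIntegral_truncatedMonomial_eq_zero {u v : ℝ} (hu : u = 1 ∨ u = -1)
    (hv : v = 1 ∨ v = -1) (hsymm : (∀ x y, ev f x y = ev f (u * x) (v * y)) ∨
      ∀ x y, ev f x y = -ev f (u * x) (v * y)) {i j : ℕ} (hij : u ^ i * v ^ j = -1) (s : ℂ) :
    zetaIntegral f (truncatedMonomial i j) s = 0 := by
  have hu1 : |u| = 1 := by rcases hu with rfl | rfl <;> simp
  have hv1 : |v| = 1 := by rcases hv with rfl | rfl <;> simp
  have habs : ∀ x y, |ev f (u * x) (v * y)| = |ev f x y| := by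
    intro x y
    rcases hsymm with h | h
    · rw [h x y]
    · rw [h x y, abs_neg]
  have htm : ∀ p : ℝ × ℝ, truncatedMonomial i j (u * p.1, v * p.2) = -truncatedMonomial i j p := by
    intro p
    by_cases hp : 1 < |p.1| ∨ 1 < |p.2|
    · rw [truncatedMonomial_eq_zero i j hp, truncatedMonomial_eq_zero i j, neg_zero]
      simpa [abs_mul, hu1, hv1] using hp
    · push Not at hp
      have h1 : p ∈ Icc (-1 : ℝ) 1 ×ˢ Icc (-1 : ℝ) 1 := ⟨abs_le.1 hp.1, abs_le.1 hp.2⟩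
      have h2 : ((u * p.1, v * p.2) : ℝ × ℝ) ∈ Icc (-1 : ℝ) 1 ×ˢ Icc (-1 : ℝ) 1 :=
        ⟨abs_le.1 (by simpa [abs_mul, hu1] using hp.1),
          abs_le.1 (by simpa [abs_mul, hv1] using hp.2)⟩
      rw [truncatedMonomial, truncatedMonomial, indicator_of_mem h1, indicator_of_mem h2]
      simp only [mul_pow]
      linear_combination p.1 ^ i * p.2 ^ j * hij
  have h2 := integral_comp_diag (u := u) (v := v) (by rintro rfl; simp at hu1)
    (by rintro rfl; simp at hv1)
    fun p => ((|ev f p.1 p.2| : ℝ) : ℂ) ^ s * (truncatedMonomial i j p : ℂ)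
  simp only [habs, htm, hu1, hv1, Complex.ofReal_neg, mul_neg, integral_neg] at h2
  unfold zetaIntegral
  have h3 : ∀ z : ℂ, -z = ((1⁻¹ * 1⁻¹ : ℝ) : ℂ) * z → z = 0 := fun z hz => by
    push_cast at hz
    linear_combination -hz / 2
  exact h3 _ h2

end RealZeta

namespace BernsteinSato

open Polynomial

/-! ### Specialising the functional equation at natural numbers, and adjoints of differential
operators -/

section Specialization

variable {σ k : Type*} [Field k]

/-- The specialisation `s = N` of coefficients. -/
noncomputable def specialize (N : ℕ) : MvPolynomial σ k[X] →+* MvPolynomial σ k :=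
  MvPolynomial.map (evalRingHom (N : k))

theorem specialize_overS (N : ℕ) (g : MvPolynomial σ k) : specialize N (overS g) = g := by
  rw [specialize, overS, MvPolynomial.map_map]
  have : (evalRingHom (N : k)).comp C = RingHom.id k := by
    ext
    simp
  rw [this, MvPolynomial.map_id]

theorem specialize_pderiv (N : ℕ) (i : σ) (r : MvPolynomial σ k[X]) :
    specialize N (MvPolynomial.pderiv i r) = MvPolynomial.pderiv i (specialize N r) :=
  MvPolynomial.pderiv_map.symm

theorem isUnit_specialize (f : MvPolynomial σ k) (N : ℕ) (y : Submonoid.powers (overS f)) :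
    IsUnit (((algebraMap (MvPolynomial σ k) (Localization.Away f)).comp (specialize N)) y) := by
  obtain ⟨_, n, rfl⟩ := y
  simp only [map_pow, RingHom.comp_apply, specialize_overS]
  exact (IsLocalization.Away.algebraMap_isUnit f).pow n

/-- The specialisation `s = N` on `k[s][x][1/f]`. -/
noncomputable def specializeLoc (f : MvPolynomial σ k) (N : ℕ) :
    TwistedModule f →+* Localization.Away f :=
  IsLocalization.lift (M := Submonoid.powers (overS f)) (isUnit_specialize f N)

theorem specializeLoc_algebraMap (f : MvPolynomial σ k) (N : ℕ) (r : MvPolynomial σ k[X]) :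
    specializeLoc f N (algebraMap _ _ r) = algebraMap _ _ (specialize N r) :=
  IsLocalization.lift_eq _ _

theorem specializeLoc_smul (f : MvPolynomial σ k) (N : ℕ) (c : k[X]) (u : TwistedModule f) :
    specializeLoc f N (c • u) =
      algebraMap (MvPolynomial σ k) _ (MvPolynomial.C (c.eval (N : k))) *
      specializeLoc f N u := by
  rw [Algebra.smul_def, map_mul, IsScalarTower.algebraMap_apply k[X] (MvPolynomial σ k[X])
    (TwistedModule f), specializeLoc_algebraMap]
  simp [specialize, MvPolynomial.algebraMap_eq]

/-- With `u * y = r` for polynomials `r` and `y`, apply both sides to this equation. They agree on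
polynomials, so the Leibniz rule leaves the claim multiplied by the unit `y`. -/
theorem specializeLoc_locDerivation (f : MvPolynomial σ k) (N : ℕ) (i : σ) (u : TwistedModule f) :
    specializeLoc f N (locDerivation (overS f) (MvPolynomial.pderiv i) u) =
      locDerivation f (MvPolynomial.pderiv i) (specializeLoc f N u) := by
  obtain ⟨⟨r, y⟩, hr⟩ := IsLocalization.surj (Submonoid.powers (overS f)) u
  simp only at hr
  have h1 := congrArg (fun w => specializeLoc f N (locDerivation (overS f) (MvPolynomial.pderiv i) w)) hr
  have h2 := congrArg (fun w => locDerivation f (MvPolynomial.pderiv i) (specializeLoc f N w)) hr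
  simp only [Derivation.leibniz, map_mul, map_add, smul_eq_mul, locDerivation_algebraMap,
    specializeLoc_algebraMap, specialize_pderiv] at h1 h2
  have h3 := h1.trans h2.symm
  rw [add_right_inj] at h3
  exact (isUnit_specialize f N y).mul_left_cancel h3

/-- The specialisation `s = N` on `k[s][x][1/f] f ^ s`, sending `g f ^ s` to `g f ^ N`. -/
noncomputable def specializeTwisted (f : MvPolynomial σ k) (N : ℕ) (u : TwistedModule f) :
    Localization.Away f :=
  specializeLoc f N u * algebraMap _ _ f ^ N

theorem specializeTwisted_actX (f : MvPolynomial σ k) (N : ℕ) (i : σ) (u : TwistedModule f) :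
    specializeTwisted f N (actX f i u) =
      algebraMap (MvPolynomial σ k) _ (MvPolynomial.X i) * specializeTwisted f N u := by
  simp only [specializeTwisted, actX, LinearMap.mulLeft_apply, map_mul, specializeLoc_algebraMap]
  simp [specialize, mul_assoc]

theorem specializeTwisted_actD (f : MvPolynomial σ k) (N : ℕ) (i : σ) (u : TwistedModule f) :
    specializeTwisted f N (actD f i u) =
      locDerivation f (MvPolynomial.pderiv i) (specializeTwisted f N u) := by
  set q : TwistedModule f := IsLocalization.mk' (TwistedModule f) (MvPolynomial.pderiv i (overS f))
        (⟨overS f, Submonoid.mem_powers _⟩ : Submonoid.powers (overS f)) with hq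
  have hact : actD f i u =
      locDerivation (overS f) (MvPolynomial.pderiv i) u + (X : k[X]) • (q * u) := rfl
  have hq1 : specializeLoc f N q * algebraMap _ _ f =
      algebraMap _ _ (MvPolynomial.pderiv i f) := by
    have h := congrArg (specializeLoc f N) (IsLocalization.mk'_spec (TwistedModule f)
      (MvPolynomial.pderiv i (overS f))
      (⟨overS f, Submonoid.mem_powers _⟩ : Submonoid.powers (overS f)))
    rw [map_mul, specializeLoc_algebraMap, specializeLoc_algebraMap, specialize_pderiv,
      specialize_overS] at h
    exact h
  rw [hact, specializeTwisted, specializeTwisted, map_add, specializeLoc_smul, map_mul,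
    specializeLoc_locDerivation, Derivation.leibniz, Derivation.leibniz_pow,
    locDerivation_algebraMap, ← hq1, eval_X, map_natCast, map_natCast]
  simp only [smul_eq_mul, nsmul_eq_mul]
  -- The Leibniz rule for `f ^ N` produces the truncated exponent `N - 1`, so `N = 0` is separate.
  cases N with
  | zero => simp
  | succ N =>
    rw [Nat.add_sub_cancel]
    ring

variable (I : MvPolynomial σ k →ₗ[k] k) {f : MvPolynomial σ k}

/-- If a functional `I` behaves like integration against `exp (-f)`, then every operator on
`k[s][x][1/f] f ^ s` has an adjoint at all polynomials. -/
theorem exists_adjoint (hI : ∀ i g, I (MvPolynomial.pderiv i g) = I (MvPolynomial.pderiv i f * g))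
    {P : Module.End k[X] (TwistedModule f)} (hP : P ∈ operators f) :
    ∀ g : MvPolynomial σ k[X], ∃ h : MvPolynomial σ k[X], ∀ (N : ℕ) (u : TwistedModule f)
      (v : MvPolynomial σ k), specializeTwisted f N u = algebraMap _ _ v →
        ∃ v' : MvPolynomial σ k, specializeTwisted f N (P u) = algebraMap _ _ v' ∧
          I (specialize N g * v') = I (specialize N h * v) := by
  -- The adjoint `h` is chosen before `N`: its coefficients are polynomials in `s`, so the
  -- dependence on `N` is polynomial.
  induction hP using Algebra.adjoin_induction with
  | mem P hP =>
    intro g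
    rcases hP with ⟨i, rfl⟩ | ⟨i, rfl⟩
    · refine ⟨g * MvPolynomial.X i, fun N u v hv => ⟨MvPolynomial.X i * v, ?_, ?_⟩⟩
      · rw [specializeTwisted_actX, hv, map_mul]
      · simp [specialize, mul_assoc]
    -- Integration by parts against `exp (-f)`: the adjoint of `∂_i` is `g ↦ (∂_i f) g - ∂_i g`.
    · refine ⟨overS (MvPolynomial.pderiv i f) * g - MvPolynomial.pderiv i g, fun N u v hv =>
        ⟨MvPolynomial.pderiv i v, ?_, ?_⟩⟩
      · rw [specializeTwisted_actD, hv, locDerivation_algebraMap]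
      · have h1 := hI i (specialize N g * v)
        rw [Derivation.leibniz, map_add] at h1
        rw [map_sub (specialize N), map_mul (specialize N), specialize_overS, specialize_pderiv,
          sub_mul, map_sub, mul_assoc, ← h1, smul_eq_mul, smul_eq_mul, mul_comm v,
          add_sub_cancel_right]
  | algebraMap c =>
    intro g
    refine ⟨MvPolynomial.C c * g, fun N u v hv => ⟨MvPolynomial.C (c.eval (N : k)) * v, ?_, ?_⟩⟩
    · rw [Module.algebraMap_end_apply, specializeTwisted, specializeLoc_smul, mul_assoc,
        ← specializeTwisted, hv, map_mul]
    · congr 1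
      simp [specialize]
      ring
  | add P Q _ _ hP hQ =>
    intro g
    obtain ⟨h₁, hh₁⟩ := hP g
    obtain ⟨h₂, hh₂⟩ := hQ g
    refine ⟨h₁ + h₂, fun N u v hv => ?_⟩
    obtain ⟨v₁, hv₁, e₁⟩ := hh₁ N u v hv
    obtain ⟨v₂, hv₂, e₂⟩ := hh₂ N u v hv
    refine ⟨v₁ + v₂, ?_, ?_⟩
    · rw [map_add, ← hv₁, ← hv₂, LinearMap.add_apply, specializeTwisted, map_add, add_mul]
      rfl
    · rw [mul_add, map_add, e₁, e₂, map_add, add_mul, map_add]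
  | mul P Q _ _ hP hQ =>
    intro g
    -- Adjoints compose in the reverse order.
    obtain ⟨h₁, hh₁⟩ := hP g
    obtain ⟨h₂, hh₂⟩ := hQ h₁
    refine ⟨h₂, fun N u v hv => ?_⟩
    obtain ⟨v₂, hv₂, e₂⟩ := hh₂ N u v hv
    obtain ⟨v₁, hv₁, e₁⟩ := hh₁ N (Q u) v₂ hv₂
    exact ⟨v₁, hv₁, e₁.trans e₂⟩

/-- Set `s = N` in `P f ^ (s + 1) = b(s) f ^ s`, multiply by `g`, apply `I` and move `P` to its
adjoint. -/
theorem exists_eval_mul_eq (hf : f ≠ 0)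
    (hI : ∀ i g, I (MvPolynomial.pderiv i g) = I (MvPolynomial.pderiv i f * g))
    {b : k[X]} (hb : b ∈ bernsteinSatoIdeal f) (g : MvPolynomial σ k) :
    ∃ h : MvPolynomial σ k[X], ∀ N : ℕ,
      b.eval (N : k) * I (g * f ^ N) = I (specialize N h * f ^ (N + 1)) := by
  obtain ⟨P, hP, hPb⟩ := hb
  obtain ⟨h, hh⟩ := exists_adjoint I hI hP (overS g)
  refine ⟨h, fun N => ?_⟩
  obtain ⟨v', hv', e⟩ := hh N (algebraMap _ _ (overS f)) (f ^ (N + 1)) (by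
    rw [specializeTwisted, specializeLoc_algebraMap, specialize_overS, map_pow, pow_succ'])
  rw [hPb, specializeTwisted, specializeLoc_smul, map_one, mul_one, ← map_pow, ← map_mul] at hv'
  have hinj : Function.Injective (algebraMap (MvPolynomial σ k) (Localization.Away f)) :=
    IsLocalization.injective _ (powers_le_nonZeroDivisors_of_noZeroDivisors hf)
  rw [← e, ← hinj hv', specialize_overS, mul_left_comm, ← MvPolynomial.smul_eq_C_mul, map_smul,
    smul_eq_mul]

end Specialization

/-! ### Moment functionals and roots of the Bernstein-Sato polynomial of `x ^ n + y ^ l` -/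

section BrieskornPham

/-- The moments of a functional on `ℝ[x]` that behaves like integration against `exp (-x ^ n)` and
lives on the exponents congruent to `i₀` modulo `n`. -/
noncomputable def moment (n i₀ i : ℕ) : ℝ :=
  if i % n = i₀ then (ascPochhammer ℝ (i / n)).eval ((i₀ + 1 : ℝ) / n) else 0

theorem moment_self {n i₀ : ℕ} (hi : i₀ + 1 < n) : moment n i₀ i₀ = 1 := by
  rw [moment, if_pos (Nat.mod_eq_of_lt (by omega)), Nat.div_eq_of_lt (by omega)]
  simp

/-- Integrating the derivative of a constant must give zero, which forces the moment of `x ^ (n -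
1)` to vanish. This is why `i₀ = n - 1` is excluded. -/
theorem moment_pred {n i₀ : ℕ} (hi : i₀ + 1 < n) : moment n i₀ (n - 1) = 0 := by
  rw [moment, if_neg]
  rw [Nat.mod_eq_of_lt (by omega)]
  omega

/-- This is the recursion that integration by parts gives for the moments of `exp (-x ^ n)`. -/
theorem moment_add {n i₀ : ℕ} (hi : i₀ + 1 < n) (i : ℕ) :
    n * moment n i₀ (i + n) = (i + 1) * moment n i₀ i := by
  have hn : 0 < n := by omega
  rw [moment, moment, Nat.add_mod_right, Nat.add_div_right _ hn]
  split_ifs with h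
  · rw [ascPochhammer_succ_eval]
    have hn' : (n : ℝ) ≠ 0 := by exact_mod_cast hn.ne'
    have h1 : (i : ℝ) = i₀ + n * (i / n : ℕ) := by
      rw [← h]
      exact_mod_cast (Nat.mod_add_div i n).symm
    have h2 : (n : ℝ) * ((i₀ + 1) / n + (i / n : ℕ)) = i + 1 := by
      rw [h1]
      field_simp
      ring
    linear_combination (ascPochhammer ℝ (i / n)).eval ((i₀ + 1 : ℝ) / n) * h2
  · simp

theorem exists_eq_of_moment_ne_zero {n i₀ i : ℕ} (h : moment n i₀ i ≠ 0) :
    ∃ t : ℕ, i = i₀ + n * t := by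
  refine ⟨i / n, ?_⟩
  rw [moment] at h
  split_ifs at h with h'
  · rw [← h']
    exact (Nat.mod_add_div i n).symm
  · simp at h

/-- The functional on `ℝ[x, y]` with product moments. -/
noncomputable def momentFunctional (p q : ℕ → ℝ) : MvPolynomial (Fin 2) ℝ →ₗ[ℝ] ℝ :=
  (MvPolynomial.basisMonomials (Fin 2) ℝ).constr ℝ fun u => p (u 0) * q (u 1)

theorem momentFunctional_monomial (p q : ℕ → ℝ) (u : Fin 2 →₀ ℕ) (c : ℝ) :
    momentFunctional p q (MvPolynomial.monomial u c) = c * (p (u 0) * q (u 1)) := by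
  have h := (MvPolynomial.basisMonomials (Fin 2) ℝ).constr_basis ℝ
    (fun u => p (u 0) * q (u 1)) u
  rw [MvPolynomial.coe_basisMonomials] at h
  have h2 : MvPolynomial.monomial u c = c • MvPolynomial.monomial u (1 : ℝ) := by
    rw [MvPolynomial.smul_monomial, smul_eq_mul, mul_one]
  rw [h2, map_smul, momentFunctional, h, smul_eq_mul]

theorem monomial_eq_X_pow (u : Fin 2 →₀ ℕ) (c : ℝ) : MvPolynomial.monomial u c =
    MvPolynomial.C c * (MvPolynomial.X 0 ^ u 0 * MvPolynomial.X 1 ^ u 1) := by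
  rw [MvPolynomial.monomial_eq, Finsupp.prod_fintype _ _ (by simp), Fin.prod_univ_two]

theorem momentFunctional_X_pow (p q : ℕ → ℝ) (i j : ℕ) :
    momentFunctional p q (MvPolynomial.X 0 ^ i * MvPolynomial.X 1 ^ j) = p i * q j := by
  have h := momentFunctional_monomial p q (Finsupp.single 0 i + Finsupp.single 1 j) 1
  rw [monomial_eq_X_pow] at h
  simpa using h

/-- The Brieskorn-Pham polynomial `x ^ n + y ^ l`. -/
noncomputable def brieskornPham (n l : ℕ) : MvPolynomial (Fin 2) ℝ :=
  MvPolynomial.X 0 ^ n + MvPolynomial.X 1 ^ l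

/-- On monomials the identity is the moment recursion in the variable differentiated. When that
variable has exponent `0`, it is the vanishing of the moment `n - 1` or `l - 1`. -/
theorem momentFunctional_pderiv {n l : ℕ} {p q : ℕ → ℝ} (hn : 0 < n) (hl : 0 < l)
    (hp0 : p (n - 1) = 0) (hp : ∀ i : ℕ, n * p (i + n) = (i + 1) * p i)
    (hq0 : q (l - 1) = 0) (hq : ∀ j : ℕ, l * q (j + l) = (j + 1) * q j) (e : Fin 2)
    (g : MvPolynomial (Fin 2) ℝ) :
    momentFunctional p q (MvPolynomial.pderiv e g) =
      momentFunctional p q (MvPolynomial.pderiv e (brieskornPham n l) * g) := by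
  induction g using MvPolynomial.induction_on' with
  | add g h hg hh => rw [map_add, map_add, mul_add, map_add, hg, hh]
  | monomial u c =>
    rw [monomial_eq_X_pow, ← MvPolynomial.smul_eq_C_mul, Derivation.map_smul, map_smul, mul_smul_comm,
      map_smul]
    congr 1
    generalize u 0 = i
    generalize u 1 = j
    obtain rfl | rfl : e = 0 ∨ e = 1 := by fin_cases e <;> simp
    · have h1 : MvPolynomial.pderiv 0 (brieskornPham n l) =
          (n : ℝ) • MvPolynomial.X 0 ^ (n - 1) := by
        simp [brieskornPham, MvPolynomial.pderiv_X, MvPolynomial.smul_eq_C_mul]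
      have h2 : MvPolynomial.pderiv 0 (MvPolynomial.X 0 ^ i * MvPolynomial.X 1 ^ j :
          MvPolynomial (Fin 2) ℝ) =
          (i : ℝ) • (MvPolynomial.X 0 ^ (i - 1) * MvPolynomial.X 1 ^ j) := by
        simp [MvPolynomial.pderiv_X, MvPolynomial.smul_eq_C_mul]
        ring
      rw [h1, h2, smul_mul_assoc, map_smul, map_smul, ← mul_assoc, ← pow_add,
        momentFunctional_X_pow, momentFunctional_X_pow, smul_eq_mul, smul_eq_mul]
      cases i with
      | zero => simp [hp0]
      | succ i =>
        rw [show n - 1 + (i + 1) = i + n by omega, ← mul_assoc (n : ℝ), hp]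
        push_cast
        simp [mul_assoc]
    · have h1 : MvPolynomial.pderiv 1 (brieskornPham n l) =
          (l : ℝ) • MvPolynomial.X 1 ^ (l - 1) := by
        simp [brieskornPham, MvPolynomial.pderiv_X, MvPolynomial.smul_eq_C_mul]
      have h2 : MvPolynomial.pderiv 1 (MvPolynomial.X 0 ^ i * MvPolynomial.X 1 ^ j :
          MvPolynomial (Fin 2) ℝ) =
          (j : ℝ) • (MvPolynomial.X 0 ^ i * MvPolynomial.X 1 ^ (j - 1)) := by
        simp [MvPolynomial.pderiv_X, MvPolynomial.smul_eq_C_mul]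
        ring
      rw [h1, h2, smul_mul_assoc, map_smul, map_smul, mul_left_comm, ← pow_add,
        momentFunctional_X_pow, momentFunctional_X_pow, smul_eq_mul, smul_eq_mul]
      cases j with
      | zero => simp [hq0]
      | succ j =>
        rw [show l - 1 + (j + 1) = j + l by omega, mul_left_comm (l : ℝ), hq,
          Nat.add_sub_cancel]
        push_cast
        ring

/-- Peeling off one factor `x ^ n + y ^ l` raises one of the two fractions by `1` and multiplies the
moment by that fraction. The two contributions add up to `w (w + 1)_N = (w)_(N + 1)`, where `w` is
the sum of the fractions. -/
theorem momentFunctional_mul_pow {n l : ℕ} {p q : ℕ → ℝ} (hn : 0 < n) (hl : 0 < l)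
    (hp : ∀ i : ℕ, n * p (i + n) = (i + 1) * p i)
    (hq : ∀ j : ℕ, l * q (j + l) = (j + 1) * q j) (N i j : ℕ) :
    momentFunctional p q (MvPolynomial.X 0 ^ i * MvPolynomial.X 1 ^ j * brieskornPham n l ^ N) =
      p i * q j * (ascPochhammer ℝ N).eval ((i + 1 : ℝ) / n + (j + 1 : ℝ) / l) := by
  have hn' : (n : ℝ) ≠ 0 := by exact_mod_cast hn.ne'
  have hl' : (l : ℝ) ≠ 0 := by exact_mod_cast hl.ne'
  induction N generalizing i j with
  | zero => simp [momentFunctional_X_pow]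
  | succ N ih =>
    have h1 : MvPolynomial.X 0 ^ i * MvPolynomial.X 1 ^ j * brieskornPham n l ^ (N + 1) =
        MvPolynomial.X 0 ^ (i + n) * MvPolynomial.X 1 ^ j * brieskornPham n l ^ N +
        MvPolynomial.X 0 ^ i * MvPolynomial.X 1 ^ (j + l) * brieskornPham n l ^ N := by
      rw [pow_succ', brieskornPham]
      ring
    rw [h1, map_add, ih, ih, ascPochhammer_succ_left, eval_mul, eval_X, eval_comp]
    have e1 : ((i + n : ℕ) + 1 : ℝ) / n + (j + 1 : ℝ) / l =
        (i + 1 : ℝ) / n + (j + 1 : ℝ) / l + 1 := by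
      push_cast
      field_simp
      ring
    have e2 : (i + 1 : ℝ) / n + ((j + l : ℕ) + 1 : ℝ) / l =
        (i + 1 : ℝ) / n + (j + 1 : ℝ) / l + 1 := by
      push_cast
      field_simp
      ring
    have e3 : p (i + n) = (i + 1 : ℝ) / n * p i := by
      rw [div_mul_eq_mul_div, eq_div_iff hn', ← hp, mul_comm]
    have e4 : q (j + l) = (j + 1 : ℝ) / l * q j := by
      rw [div_mul_eq_mul_div, eq_div_iff hl', ← hq, mul_comm]
    rw [e1, e2, e3, e4, eval_add, eval_X, eval_one]
    ring

/-- Splitting `(w)_(N + t + 1)` in two ways gives `(w)_t (w + t)_(N + 1) = (w)_N (w + N) (w + N +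
1)_t`. -/
theorem exists_ascPochhammer_shift {w : ℝ} (hw : 0 < w) (t : ℕ) :
    ∃ r : ℝ[X], ∀ N : ℕ, (ascPochhammer ℝ (N + 1)).eval (w + t) =
      (N + w) * r.eval (N : ℝ) * (ascPochhammer ℝ N).eval w := by
  have ht : (ascPochhammer ℝ t).eval w ≠ 0 := (ascPochhammer_pos t w hw).ne'
  refine ⟨C ((ascPochhammer ℝ t).eval w)⁻¹ * (ascPochhammer ℝ t).comp (X + C (w + 1)),
    fun N => ?_⟩
  have h1 := congrArg (eval w) (ascPochhammer_mul ℝ t (N + 1))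
  have h2 := congrArg (eval w) (ascPochhammer_mul ℝ N (t + 1))
  rw [show N + (t + 1) = t + (N + 1) by ring] at h2
  rw [← h2] at h1
  simp only [eval_mul, eval_comp, eval_add, eval_X, eval_natCast, eval_C] at h1 ⊢
  rw [ascPochhammer_succ_left ℝ t, eval_mul, eval_X, eval_comp, eval_add, eval_X, eval_one] at h1
  rw [show (N : ℝ) + (w + 1) = w + N + 1 by ring]
  field_simp
  linear_combination h1

theorem isRoot_of_mem_bernsteinSatoIdeal {n l i₀ j₀ : ℕ} (hi : i₀ + 1 < n) (hj : j₀ + 1 < l)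
    {b : ℝ[X]} (hb : b ∈ bernsteinSatoIdeal (brieskornPham n l)) :
    b.eval (-((i₀ + 1 : ℝ) / n + (j₀ + 1 : ℝ) / l)) = 0 := by
  have hn : 0 < n := by omega
  have hl : 0 < l := by omega
  have hn' : (0 : ℝ) < n := by exact_mod_cast hn
  have hl' : (0 : ℝ) < l := by exact_mod_cast hl
  set w : ℝ := (i₀ + 1 : ℝ) / n + (j₀ + 1 : ℝ) / l with hw
  have hwpos : 0 < w := by positivity
  set p := moment n i₀ with hp
  set q := moment l j₀ with hq
  have hmul := momentFunctional_mul_pow hn hl (moment_add hi) (moment_add hj)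
  -- The functional sends `x ^ i₀ * y ^ j₀ * f` to `w > 0`.
  have hf : brieskornPham n l ≠ 0 := by
    intro h0
    have := hmul 1 i₀ j₀
    rw [h0, zero_pow one_ne_zero, mul_zero, map_zero, moment_self hi, moment_self hj] at this
    simp [← hw] at this
    exact hwpos.ne this
  obtain ⟨h, hh⟩ := exists_eval_mul_eq (momentFunctional p q) hf
    (momentFunctional_pderiv hn hl (moment_pred hi) (moment_add hi) (moment_pred hj)
      (moment_add hj)) hb (MvPolynomial.X 0 ^ i₀ * MvPolynomial.X 1 ^ j₀)
  have hr : ∀ u : Fin 2 →₀ ℕ, ∃ r : ℝ[X], ∀ N : ℕ, p (u 0) * q (u 1) *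
      (ascPochhammer ℝ (N + 1)).eval ((u 0 + 1 : ℝ) / n + (u 1 + 1 : ℝ) / l) =
        (N + w) * r.eval (N : ℝ) * (ascPochhammer ℝ N).eval w := by
    intro u
    -- Only exponents `(i₀ + n t₁, j₀ + l t₂)` contribute, and they shift `w` by the natural number
    -- `t₁ + t₂`.
    by_cases h0 : p (u 0) * q (u 1) = 0
    · exact ⟨0, fun N => by simp [h0]⟩
    obtain ⟨t₁, ht₁⟩ := exists_eq_of_moment_ne_zero (left_ne_zero_of_mul h0)
    obtain ⟨t₂, ht₂⟩ := exists_eq_of_moment_ne_zero (right_ne_zero_of_mul h0)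
    obtain ⟨r, hr⟩ := exists_ascPochhammer_shift hwpos (t₁ + t₂)
    refine ⟨C (p (u 0) * q (u 1)) * r, fun N => ?_⟩
    have hwu : (u 0 + 1 : ℝ) / n + (u 1 + 1 : ℝ) / l = w + (t₁ + t₂ : ℕ) := by
      rw [ht₁, ht₂, hw]
      push_cast
      field_simp
      ring
    rw [hwu, hr, eval_mul, eval_C]
    ring
  choose r hr using hr
  -- Both sides agree at every natural number `N`, after cancelling `(w)_N`, which is nonzero
  -- because `w > 0`.
  have key : b = (X + C w) * ∑ u ∈ h.support, h.coeff u * r u := by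
    refine Polynomial.eq_of_infinite_eval_eq _ _ (Set.Infinite.mono ?_
      (Set.infinite_range_of_injective (Nat.cast_injective (R := ℝ))))
    rintro _ ⟨N, rfl⟩
    have hN := hh N
    have hpos : (ascPochhammer ℝ N).eval w ≠ 0 := (ascPochhammer_pos N w hwpos).ne'
    rw [hmul, hp, hq, moment_self hi, moment_self hj, one_mul, one_mul, ← hw] at hN
    refine mul_right_cancel₀ hpos (hN.trans ?_)
    have hspec : specialize N h = ∑ u ∈ h.support, (h.coeff u).eval (N : ℝ) •
        (MvPolynomial.X 0 ^ u 0 * MvPolynomial.X 1 ^ u 1 : MvPolynomial (Fin 2) ℝ) := by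
      conv_lhs => rw [h.as_sum, map_sum]
      refine Finset.sum_congr rfl fun u _ => ?_
      rw [specialize, MvPolynomial.map_monomial, monomial_eq_X_pow, MvPolynomial.smul_eq_C_mul]
      rfl
    rw [hspec, Finset.sum_mul, map_sum, eval_mul, eval_finsetSum, Finset.mul_sum, Finset.sum_mul]
    refine Finset.sum_congr rfl fun u _ => ?_
    rw [smul_mul_assoc, map_smul, hmul, hr, smul_eq_mul, eval_mul, eval_add, eval_X, eval_C]
    ring
  rw [key, eval_mul]
  simp

theorem isRoot_bernsteinSatoPolynomial {n l i₀ j₀ : ℕ} (hi : i₀ + 1 < n) (hj : j₀ + 1 < l) :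
    (bernsteinSatoPolynomial (brieskornPham n l)).IsRoot
      (-((i₀ + 1 : ℝ) / n + (j₀ + 1 : ℝ) / l)) := by
  rw [IsRoot, bernsteinSatoPolynomial, eval_mul, isRoot_of_mem_bernsteinSatoIdeal hi hj
    (Submodule.IsPrincipal.generator_mem _), zero_mul]

end BrieskornPham

end BernsteinSato

/-! ### The symmetry criterion, the parity example and the two explicit curves -/

namespace RealZeta

open MvPolynomial Filter

variable {f : MvPolynomial (Fin 2) ℝ} {a b m : ℕ}

theorem not_isZetaPole_of_symmetry (ha : 0 < a) (hb : 0 < b)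
    (h : IsWeightedHomogeneousOfType f a b m) (hf : HasIsolatedSingularityAtOrigin f)
    {u v : ℝ} (hu : u = 1 ∨ u = -1) (hv : v = 1 ∨ v = -1)
    (hsymm : (∀ x y, ev f x y = ev f (u * x) (v * y)) ∨ ∀ x y, ev f x y = -ev f (u * x) (v * y))
    {d : ℕ} (hd : d < m)
    (hrep : ∀ i j : ℕ, d = (i + 1) * a + (j + 1) * b → u ^ i * v ^ j = -1)
    {φ : ℝ × ℝ → ℝ} (hφ : IsTestFunction φ) : ¬ IsZetaPole f φ (-(d : ℂ) / m) :=
  not_isZetaPole ha hb h hf hφ hd fun i j hij s _ =>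
    zetaIntegral_truncatedMonomial_eq_zero hu hv hsymm (hrep i j hij) s

/-- The equation says `i * a + j * b = min a b`, which leaves only `(1, 0)` and `(0, 1)` for `(i,
j)`. -/
theorem odd_add_of_eq_add_min (ha : 0 < a) (hb : 0 < b) {i j : ℕ}
    (h : a + b + min a b = (i + 1) * a + (j + 1) * b) : Odd (i + j) := by
  have h1 : i * a + j * b = min a b := by linarith
  rcases Nat.eq_zero_or_pos i with rfl | hi <;> rcases Nat.eq_zero_or_pos j with rfl | hj
  · rcases min_cases a b with ⟨h2, _⟩ | ⟨h2, _⟩ <;> omega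
  · have h2 : j * b ≤ 1 * b := by
      rw [one_mul]
      exact (by omega : j * b ≤ min a b).trans (min_le_right a b)
    have := Nat.le_of_mul_le_mul_right h2 hb
    exact ⟨0, by omega⟩
  · have h2 : i * a ≤ 1 * a := by
      rw [one_mul]
      exact (by omega : i * a ≤ min a b).trans (min_le_left a b)
    have := Nat.le_of_mul_le_mul_right h2 ha
    exact ⟨0, by omega⟩
  · have h2 : a ≤ i * a := Nat.le_mul_of_pos_left a hi
    have h3 : b ≤ j * b := Nat.le_mul_of_pos_left b hj
    have h4 := min_le_left a b
    omega

theorem isWeightedHomogeneousOfType_brieskornPham {n l : ℕ} (hna : n * a = m) (hlb : l * b = m) :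
    IsWeightedHomogeneousOfType (X 0 ^ n + X 1 ^ l) a b m := by
  intro c x y
  simp only [ev, map_add, map_pow, eval_X, Matrix.cons_val_zero, Matrix.cons_val_one, mul_pow,
    ← pow_mul, mul_comm a, mul_comm b, hna, hlb]
  ring

theorem hasIsolatedSingularityAtOrigin_brieskornPham {n l : ℕ} (hn : 2 ≤ n) (hl : 2 ≤ l) :
    HasIsolatedSingularityAtOrigin (X 0 ^ n + X 1 ^ l) := by
  have hn1 : n - 1 ≠ 0 := by omega
  have hl1 : l - 1 ≠ 0 := by omega
  have hn0 : n ≠ 0 := by omega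
  have hl0 : l ≠ 0 := by omega
  refine ⟨⟨?_, ?_, ?_⟩, ?_⟩
  · simp [ev, hn0, hl0]
  · simp [ev, pderiv_X, hn1]
  · simp [ev, pderiv_X, hl1]
  · filter_upwards [self_mem_nhdsWithin] with p hp hs
    obtain ⟨-, h1, h2⟩ := hs
    simp [ev, pderiv_X, hn0, hl0] at h1 h2
    exact hp (Prod.ext h1.1 h2.1)

end RealZeta

theorem mainTheorem3 :
    (∀ (f : MvPolynomial (Fin 2) ℝ) (a b m : ℕ), 0 < a → 0 < b →
      RealZeta.IsWeightedHomogeneousOfType f a b m →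
      RealZeta.HasIsolatedSingularityAtOrigin f →
      -- the meromorphic continuation to `Re s > -1` exists
      (∀ φ : ℝ × ℝ → ℝ, RealZeta.IsTestFunction φ → ∃ F, RealZeta.IsZetaContinuation f φ F) ∧
      ∀ d : ℕ, 0 < d → d < m →
        -- `f(x, y) = ± f(-x, -y)`
        (((∀ x y : ℝ, RealZeta.ev f x y = RealZeta.ev f (-x) (-y)) ∨
            (∀ x y : ℝ, RealZeta.ev f x y = -RealZeta.ev f (-x) (-y))) →
          (∀ i j : ℕ, d = (i + 1) * a + (j + 1) * b → Odd (i + j)) →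
          ∀ φ : ℝ × ℝ → ℝ, RealZeta.IsTestFunction φ →
            ¬ RealZeta.IsZetaPole f φ (-(d : ℂ) / (m : ℂ))) ∧
        -- the parity condition holds for `d = a + b + min {a, b}`
        (d = a + b + min a b →
          ∀ i j : ℕ, d = (i + 1) * a + (j + 1) * b → Odd (i + j)) ∧
        -- `f(x, y) = ± f(-x, y)`
        (((∀ x y : ℝ, RealZeta.ev f x y = RealZeta.ev f (-x) y) ∨
            (∀ x y : ℝ, RealZeta.ev f x y = -RealZeta.ev f (-x) y)) →
          (∀ i j : ℕ, d = (i + 1) * a + (j + 1) * b → Odd i) →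
          ∀ φ : ℝ × ℝ → ℝ, RealZeta.IsTestFunction φ →
            ¬ RealZeta.IsZetaPole f φ (-(d : ℂ) / (m : ℂ))) ∧
        -- `f(x, y) = ± f(x, -y)`
        (((∀ x y : ℝ, RealZeta.ev f x y = RealZeta.ev f x (-y)) ∨
            (∀ x y : ℝ, RealZeta.ev f x y = -RealZeta.ev f x (-y))) →
          (∀ i j : ℕ, d = (i + 1) * a + (j + 1) * b → Odd j) →
          ∀ φ : ℝ × ℝ → ℝ, RealZeta.IsTestFunction φ →
            ¬ RealZeta.IsZetaPole f φ (-(d : ℂ) / (m : ℂ)))) ∧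
    -- `-5/6` is a root of `b_f`, but never a pole, for `f = x⁴ + y³`
    ((BernsteinSato.bernsteinSatoPolynomial
        (MvPolynomial.X 0 ^ 4 + MvPolynomial.X 1 ^ 3 : MvPolynomial (Fin 2) ℝ)).IsRoot (-5 / 6) ∧
      ∀ φ : ℝ × ℝ → ℝ, RealZeta.IsTestFunction φ →
        (∃ F, RealZeta.IsZetaContinuation (MvPolynomial.X 0 ^ 4 + MvPolynomial.X 1 ^ 3) φ F) ∧
        ¬ RealZeta.IsZetaPole (MvPolynomial.X 0 ^ 4 + MvPolynomial.X 1 ^ 3) φ (-5 / 6)) ∧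
    -- `-11/15` is a root of `b_f`, but never a pole, for `f = x³ + y⁵`
    ((BernsteinSato.bernsteinSatoPolynomial
        (MvPolynomial.X 0 ^ 3 + MvPolynomial.X 1 ^ 5 : MvPolynomial (Fin 2) ℝ)).IsRoot (-11 / 15) ∧
      ∀ φ : ℝ × ℝ → ℝ, RealZeta.IsTestFunction φ →
        (∃ F, RealZeta.IsZetaContinuation (MvPolynomial.X 0 ^ 3 + MvPolynomial.X 1 ^ 5) φ F) ∧
        ¬ RealZeta.IsZetaPole (MvPolynomial.X 0 ^ 3 + MvPolynomial.X 1 ^ 5) φ (-11 / 15)) := by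
  refine ⟨fun f a b m ha hb h hf => ⟨fun φ hφ => ?_, fun d _ hd => ⟨?_, ?_, ?_, ?_⟩⟩,
    ⟨?_, fun φ hφ => ⟨?_, ?_⟩⟩, ⟨?_, fun φ hφ => ⟨?_, ?_⟩⟩⟩
  · obtain ⟨G, hG, -⟩ := RealZeta.exists_continuation ha hb h hf hφ
    exact ⟨G, hG⟩
  · intro hsymm hodd φ hφ
    refine RealZeta.not_isZetaPole_of_symmetry ha hb h hf (u := -1) (v := -1) (Or.inr rfl)
      (Or.inr rfl) (by simpa using hsymm) hd (fun i j hij => ?_) hφ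
    rw [← pow_add]
    exact (hodd i j hij).neg_one_pow
  · rintro rfl i j hij
    exact RealZeta.odd_add_of_eq_add_min ha hb hij
  · intro hsymm hodd φ hφ
    refine RealZeta.not_isZetaPole_of_symmetry ha hb h hf (u := -1) (v := 1) (Or.inr rfl)
      (Or.inl rfl) (by simpa using hsymm) hd (fun i j hij => ?_) hφ
    rw [one_pow, mul_one]
    exact (hodd i j hij).neg_one_pow
  · intro hsymm hodd φ hφ
    refine RealZeta.not_isZetaPole_of_symmetry ha hb h hf (u := 1) (v := -1) (Or.inl rfl)
      (Or.inr rfl) (by simpa using hsymm) hd (fun i j hij => ?_) hφ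
    rw [one_pow, one_mul]
    exact (hodd i j hij).neg_one_pow
  · have h := BernsteinSato.isRoot_bernsteinSatoPolynomial (n := 4) (l := 3) (i₀ := 1) (j₀ := 0)
      (by norm_num) (by norm_num)
    rw [BernsteinSato.brieskornPham] at h
    convert h using 1
    norm_num
  · obtain ⟨G, hG, -⟩ := RealZeta.exists_continuation (a := 3) (b := 4) (m := 12) (by norm_num)
      (by norm_num) (RealZeta.isWeightedHomogeneousOfType_brieskornPham rfl rfl)
      (RealZeta.hasIsolatedSingularityAtOrigin_brieskornPham (n := 4) (l := 3) (by norm_num)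
        (by norm_num)) hφ
    exact ⟨G, hG⟩
  -- Here `-5/6 = -10/12`, the only representation of `10` is `2 * 3 + 1 * 4`, and `f` is even in
  -- `x`.
  · have h := RealZeta.not_isZetaPole_of_symmetry (a := 3) (b := 4) (m := 12) (by norm_num)
      (by norm_num) (RealZeta.isWeightedHomogeneousOfType_brieskornPham rfl rfl)
      (RealZeta.hasIsolatedSingularityAtOrigin_brieskornPham (n := 4) (l := 3) (by norm_num)
        (by norm_num)) (u := -1) (v := 1) (Or.inr rfl) (Or.inl rfl)
      (Or.inl fun x y => by simp [RealZeta.ev, Even.neg_pow (by decide : Even 4)]) (d := 10)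
      (by norm_num) (fun i j hij => by
        obtain ⟨rfl, rfl⟩ : i = 1 ∧ j = 0 := by omega
        norm_num) hφ
    convert h using 1
    norm_num
  · have h := BernsteinSato.isRoot_bernsteinSatoPolynomial (n := 3) (l := 5) (i₀ := 0) (j₀ := 1)
      (by norm_num) (by norm_num)
    rw [BernsteinSato.brieskornPham] at h
    convert h using 1
    norm_num
  · obtain ⟨G, hG, -⟩ := RealZeta.exists_continuation (a := 5) (b := 3) (m := 15) (by norm_num)
      (by norm_num) (RealZeta.isWeightedHomogeneousOfType_brieskornPham rfl rfl)
      (RealZeta.hasIsolatedSingularityAtOrigin_brieskornPham (n := 3) (l := 5) (by norm_num)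
        (by norm_num)) hφ
    exact ⟨G, hG⟩
  -- The only representation of `11` is `1 * 5 + 2 * 3`, and `f` is odd under `(x, y) ↦ (-x, -y)`.
  · have h := RealZeta.not_isZetaPole_of_symmetry (a := 5) (b := 3) (m := 15) (by norm_num)
      (by norm_num) (RealZeta.isWeightedHomogeneousOfType_brieskornPham rfl rfl)
      (RealZeta.hasIsolatedSingularityAtOrigin_brieskornPham (n := 3) (l := 5) (by norm_num)
        (by norm_num)) (u := -1) (v := -1) (Or.inr rfl) (Or.inr rfl)
      (Or.inr fun x y => by
        simp [RealZeta.ev, Odd.neg_pow (by decide : Odd 3), Odd.neg_pow (by decide : Odd 5)]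
        ring) (d := 11)
      (by norm_num) (fun i j hij => by
        obtain ⟨rfl, rfl⟩ : i = 0 ∧ j = 1 := by omega
        norm_num) hφ
    convert h using 1
    norm_num
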